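/- Let $N\ge 1$ and let $\alpha,\eta,\theta,R$ be real $N\times N$ matrices with $\alpha^{T}=\alpha>0$, $\eta^{T}=\eta>0$ (the duality condition), $\theta^{T}=-\theta$, $R^{T}=R\ge 0$, and $N_R:=\operatorname{rank}R>0$. For $\beta\ge 0$ consider the system operator of the Lagrangian system $\alpha\ddot Q+(2\theta+\beta R)\dot Q+\eta Q=0$, i.e. the $2N\times 2N$ matrix $$A(\beta)=\Omega-\mathrm{i}\beta B,\qquad \Omega=\begin{bmatrix}-2\mathrm{i}K_p\theta K_p^{T}&-\mathrm{i}\Phi^{T}\\ \mathrm{i}\Phi&0\end{bmatrix},\quad B=\begin{bmatrix}K_pRK_p^{T}&0\\0&0\end{bmatrix},$$ where $K_p=\sqrt{\alpha}^{\,-1}$, $K_q=\sqrt{\eta}$, $\Phi=K_qK_p^{T}$. By high-loss-regime eigenpairs of $A(\beta)$ we mean functions $\zeta_j(\beta)\in\mathbb C$, $w_j(\beta)\in\mathbb C^{2N}$, $1\le j\le 2N$, such that for all sufficiently large $\beta$ the vectors $w_1(\beta),\dots,w_{2N}(\beta)$ form a basis of $\mathbb C^{2N}$ with $A(\beta)w_j(\beta)=\zeta_j(\beta)w_j(\beta)$,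 all $w_j$ are analytic in $\beta^{-1}$ at $\beta=\infty$, the eigenvalues $\zeta_j$ with $1\le j\le N_R$ (high-loss) have a pole at $\beta=\infty$, and the eigenvalues $\zeta_j$ with $N_R+1\le j\le 2N$ (low-loss) are analytic in $\beta^{-1}$ at $\beta=\infty$. Then, counted with algebraic multiplicity, $\eta^{-1}R$ has exactly $N_R$ nonzero complex eigenvalues, all of them positive real numbers; list them, repeated according to their multiplicities, as $0<b_1^{\flat}\le\dots\le b_{N_R}^{\flat}$. High-loss-regime eigenpairs of $A(\beta)$ exist, and any such family can be reindexed, by a permutation of $\{1,\dots,2N\}$ that fixes $1,\dots,N_R$, so that afterwards $$\zeta_j(\beta)\to 0\quad\text{and}\quad \zeta_j(\beta)=-\mathrm{i}\,\frac{1}{b^{\flat}_{j-N_R}}\,\beta^{-1}+O(\beta^{-2})\quad(\beta\to\infty),\qquad N_R+1\le j\le 2N_R,$$ while for $2N_R+1\le j\le 2N$ the limit $\lim_{\beta\to\infty}\zeta_j(\beta)$ exists and is a nonzero real number. -/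

import Mathlib

open Filter Asymptotics
open scoped Matrix MatrixOrder Topology

noncomputable section

/-- Entrywise complexification of a real matrix. -/
def complexify {m n : Type*} (M : Matrix m n ℝ) : Matrix m n ℂ := M.map Complex.ofReal

/-- `K_p`, the inverse of the positive definite square root of `α`. -/
def Kp {N : ℕ} (α : Matrix (Fin N) (Fin N) ℝ) : Matrix (Fin N) (Fin N) ℝ := (CFC.sqrt α)⁻¹

/-- `K_q`, the positive semidefinite square root of `η`. -/
def Kq {N : ℕ} (η : Matrix (Fin N) (Fin N) ℝ) : Matrix (Fin N) (Fin N) ℝ := CFC.sqrt η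

/-- `Φ = K_q K_pᵀ`. -/
def Phi {N : ℕ} (α η : Matrix (Fin N) (Fin N) ℝ) : Matrix (Fin N) (Fin N) ℝ := Kq η * (Kp α)ᵀ

/-- The frequency operator `Ω = [[-2i K_p θ K_pᵀ, -i Φᵀ], [i Φ, 0]]`. -/
def frequencyOperator {N : ℕ} (α η θ : Matrix (Fin N) (Fin N) ℝ) :
    Matrix (Fin N ⊕ Fin N) (Fin N ⊕ Fin N) ℂ :=
  Matrix.fromBlocks ((-2 * Complex.I) • complexify (Kp α * θ * (Kp α)ᵀ))
    ((-Complex.I) • complexify (Phi α η)ᵀ) (Complex.I • complexify (Phi α η)) 0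

/-- The power dissipation operator `B = [[K_p R K_pᵀ, 0], [0, 0]]`. -/
def dissipationOperator {N : ℕ} (α R : Matrix (Fin N) (Fin N) ℝ) :
    Matrix (Fin N ⊕ Fin N) (Fin N ⊕ Fin N) ℂ :=
  Matrix.fromBlocks (complexify (Kp α * R * (Kp α)ᵀ)) 0 0 0

/-- The system operator `A(β) = Ω - i β B` of the Lagrangian system
`α Q'' + (2 θ + β R) Q' + η Q = 0`. -/
def systemOperator {N : ℕ} (α η θ R : Matrix (Fin N) (Fin N) ℝ) (β : ℝ) :
    Matrix (Fin N ⊕ Fin N) (Fin N ⊕ Fin N) ℂ :=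
  frequencyOperator α η θ - (Complex.I * (β : ℂ)) • dissipationOperator α R

/-- `f` is analytic at `β = ∞`: for large `β` it is given by a convergent power series in
`β⁻¹`. -/
def AnalyticAtInfty {E : Type*} [NormedAddCommGroup E] [NormedSpace ℂ E] (f : ℝ → E) : Prop :=
  ∃ g : ℂ → E, AnalyticAt ℂ g 0 ∧ ∀ᶠ β : ℝ in atTop, f β = g ((β : ℂ)⁻¹)

/-- `f` has a pole at `β = ∞`: for large `β` it is given by a convergent Laurent series in
`β⁻¹` with finitely many, and at least one, negative powers of `β⁻¹`. -/
def HasPoleAtInfty (f : ℝ → ℂ) : Prop :=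
  ∃ g : ℂ → ℂ, MeromorphicAt g 0 ∧ meromorphicOrderAt g 0 < 0 ∧
    ∀ᶠ β : ℝ in atTop, f β = g ((β : ℂ)⁻¹)

/-- `(ζ j, w j)`, `0 ≤ j < 2N`, are the eigenpairs of the system operator in the high-loss regime:
for large `β` the `w j β` are a basis of `ℂ²ᴺ` consisting of eigenvectors of `A(β)` with
eigenvalues `ζ j β`, all eigenvectors are analytic at `β = ∞`, the first `N_R = rank R` eigenvalues
(the high-loss ones) have a pole at `β = ∞`, and the other ones (the low-loss ones) are analytic
at `β = ∞`. -/
structure IsHighLossEigenbasis {N : ℕ} (α η θ R : Matrix (Fin N) (Fin N) ℝ)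
    (ζ : Fin (2 * N) → ℝ → ℂ) (w : Fin (2 * N) → ℝ → Fin N ⊕ Fin N → ℂ) : Prop where
  basis : ∀ᶠ β : ℝ in atTop, LinearIndependent ℂ (fun j => w j β) ∧
    Submodule.span ℂ (Set.range fun j => w j β) = ⊤
  eigen : ∀ᶠ β : ℝ in atTop, ∀ j, systemOperator α η θ R β *ᵥ w j β = ζ j β • w j β
  analytic_vec : ∀ j, AnalyticAtInfty (w j)
  highLoss : ∀ j : Fin (2 * N), (j : ℕ) < R.rank → HasPoleAtInfty (ζ j)
  lowLoss : ∀ j : Fin (2 * N), R.rank ≤ (j : ℕ) → AnalyticAtInfty (ζ j)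

/-- `b` lists all nonzero (complex) eigenvalues of the real square matrix `M`, which are therefore
real, in increasing order and repeated according to their algebraic multiplicities. -/
def ListsNonzeroEigenvalues {N r : ℕ} (M : Matrix (Fin N) (Fin N) ℝ) (b : Fin r → ℝ) : Prop :=
  Monotone b ∧
    Finset.univ.val.map (fun k => (b k : ℂ)) =
      (complexify M).charpoly.roots.filter (fun x => x ≠ 0)

end

/-!
Writing `A(β) = -iβ (B + iβ⁻¹Ω)` with `B`, `Ω` Hermitian, existence of the eigenpairs is Rellich's
theorem for the symmetric family `B + zΩ` near `z = 0`: subtract the normalised trace, divide by the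
largest power of `z`, so that the value at `0` is symmetric and not scalar, block-diagonalise along
one of its eigenspaces by an analytic similarity, and induct on the dimension.

The leading coefficients are read off the characteristic polynomial. A Schur complement gives
`det (ζ - A(β)) = (det K_p)² det (ζ²α + iζ(2θ + βR) - η)`; at `ζ = μ/β` the second determinant tends
to `det (iμR - η)`, whose roots are `μ = -i/b` with `b` a nonzero eigenvalue of `η⁻¹R`. On the other
hand `det (ζ - A(β))` is the product of the factors `μ/β - ζ_j(β)`. After multiplication by suitable
powers of `β`, a factor whose `ζ_j` has a pole or a nonzero limit tends to a nonzero constant, while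
one with `ζ_j = c/β + O(β⁻²)` tends to `μ - c`. Hence the `c` are exactly the numbers `-i/b`.

Low-loss limits are real because the limit `w₀` of the eigenvector lies in `ker B`, so that the
limit of `ζ_j` is the Rayleigh quotient `⟪w₀, Ω w₀⟫ / ⟪w₀, w₀⟫`.
-/

section

open scoped ComplexConjugate Polynomial

section InverseFunction

variable {𝕜 E : Type*} [RCLike 𝕜] [NormedAddCommGroup E] [NormedSpace 𝕜 E] [FiniteDimensional 𝕜 E]

lemma exists_analyticAt_rightInverse {f : E → E} {f' : E →L[𝕜] E} {x : E}
    (hf : AnalyticAt 𝕜 f x) (hf' : HasFDerivAt f f' x) (hinj : Function.Injective f') :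
    ∃ g : E → E, AnalyticAt 𝕜 g (f x) ∧ g (f x) = x ∧ ∀ᶠ y in 𝓝 (f x), f (g y) = y := by
  have : CompleteSpace E := FiniteDimensional.complete 𝕜 E
  let e : E ≃L[𝕜] E := (LinearEquiv.ofInjectiveEndo f'.toLinearMap hinj).toContinuousLinearEquiv
  have he : HasFDerivAt f (e : E →L[𝕜] E) x := hf'.congr_fderiv rfl
  have hcd : ContDiffAt 𝕜 ⊤ f x := hf.contDiffAt
  have hstrict := hcd.hasStrictFDerivAt' he (by simp)
  exact ⟨hstrict.localInverse, (hcd.to_localInverse he (by simp)).analyticAt,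
    hstrict.localInverse_apply_image, hstrict.eventually_right_inverse⟩

end InverseFunction

section BlockDiagonalization

variable {𝕜 A : Type*} [RCLike 𝕜] [NormedRing A] [NormedAlgebra 𝕜 A] {p a c : A}

variable (𝕜) in
/-- The diagonal part of an element of a Banach algebra in its Peirce decomposition with respect to
an idempotent `p`. -/
noncomputable def peirceDiagonal (p : A) : A →L[𝕜] A :=
  ContinuousLinearMap.mulLeftRight 𝕜 A p p + ContinuousLinearMap.mulLeftRight 𝕜 A (1 - p) (1 - p)

lemma peirceDiagonal_apply (p a : A) :
    peirceDiagonal 𝕜 p a = p * a * p + (1 - p) * a * (1 - p) := rfl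

lemma commute_peirceDiagonal (hp : IsIdempotentElem p) (a : A) :
    Commute p (peirceDiagonal 𝕜 p a) := by
  simp only [Commute, SemiconjBy, peirceDiagonal_apply, mul_add, add_mul, mul_assoc,
    hp.one_sub_mul_self, hp.eq, mul_zero, add_zero]
  simp only [← mul_assoc, hp.eq, hp.mul_one_sub_self, zero_mul, add_zero]

lemma peirceDiagonal_mul_right (hc : Commute c p) (a : A) :
    peirceDiagonal 𝕜 p (a * c) = peirceDiagonal 𝕜 p a * c := by
  simp only [peirceDiagonal_apply, add_mul, mul_assoc, hc.eq,
    ((Commute.one_right c).sub_right hc).eq]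

lemma peirceDiagonal_mul_left (hc : Commute c p) (a : A) :
    peirceDiagonal 𝕜 p (c * a) = c * peirceDiagonal 𝕜 p a := by
  simp only [peirceDiagonal_apply, mul_add, ← mul_assoc, hc.eq,
    ((Commute.one_right c).sub_right hc).eq]

lemma peirceDiagonal_eq_self (hp : IsIdempotentElem p) (hc : Commute c p) :
    peirceDiagonal 𝕜 p c = c := by
  rw [← mul_one c, peirceDiagonal_mul_left hc, peirceDiagonal_apply, mul_one, hp.eq, mul_one,
    hp.one_sub.eq, add_sub_cancel]

lemma injective_peirceDiagonal_add_commutator (hp : IsIdempotentElem p)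
    (ha : ∀ y, Commute y a → Commute y p) :
    Function.Injective (peirceDiagonal 𝕜 p + ((ContinuousLinearMap.mul 𝕜 A).flip a -
      ContinuousLinearMap.mul 𝕜 A a).comp (.id 𝕜 A - peirceDiagonal 𝕜 p) : A →L[𝕜] A) := by
  have hap : Commute a p := ha a (Commute.refl a)
  refine (injective_iff_map_eq_zero _).2 fun y hy => ?_
  set D := peirceDiagonal 𝕜 p with hD
  replace hy : D y + ((y - D y) * a - a * (y - D y)) = 0 := hy
  have hDD : D (D y) = D y := peirceDiagonal_eq_self hp (commute_peirceDiagonal hp y).symm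
  have hcomm : D ((y - D y) * a - a * (y - D y)) = 0 := by
    rw [map_sub, peirceDiagonal_mul_right hap, peirceDiagonal_mul_left hap, ← hD, map_sub, hDD,
      sub_self, zero_mul, mul_zero, sub_zero]
  have hDy : D y = 0 := by
    simpa only [map_add, hDD, hcomm, add_zero, map_zero] using congrArg D hy
  have hya : Commute y a := by
    rwa [hDy, sub_zero, zero_add, sub_eq_zero] at hy
  rw [← hDy, hD, peirceDiagonal_eq_self hp (ha y hya)]

variable (D O : A →L[𝕜] A)

lemma analyticAt_conj_one_add [CompleteSpace A] (hO : O a = 0) :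
    AnalyticAt 𝕜 (fun m => (1 + O m) * D m * Ring.inverse (1 + O m)) a := by
  have hone_add : AnalyticAt 𝕜 (fun m => 1 + O m) a := analyticAt_const.add (O.analyticAt a)
  refine (hone_add.mul (D.analyticAt a)).mul (AnalyticAt.fun_comp ?_ hone_add)
  rw [hO, add_zero]
  exact analyticAt_inverse (1 : Aˣ)

lemma hasFDerivAt_conj_one_add [CompleteSpace A] (hO : O a = 0) :
    HasFDerivAt (fun m => (1 + O m) * D m * Ring.inverse (1 + O m))
      (D + ((ContinuousLinearMap.mul 𝕜 A).flip (D a) - ContinuousLinearMap.mul 𝕜 A (D a)).comp O)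
      a := by
  have hone_add : HasFDerivAt (fun m => 1 + O m) O a := O.hasFDerivAt.const_add 1
  have hinv : HasFDerivAt Ring.inverse (-ContinuousLinearMap.id 𝕜 A) (1 + O a) := by
    rw [hO, add_zero]
    refine (hasFDerivAt_ringInverse (𝕜 := 𝕜) (1 : Aˣ)).congr_fderiv ?_
    ext y
    simp
  refine ((hone_add.mul' D.hasFDerivAt).mul' (hinv.comp a hone_add)).congr_fderiv ?_
  ext y
  simp [hO]
  abel

theorem exists_analyticAt_blockDiagonalization [FiniteDimensional 𝕜 A] (hp : IsIdempotentElem p)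
    (ha : ∀ y, Commute y a → Commute y p) :
    ∃ s d : A → A, AnalyticAt 𝕜 s a ∧ AnalyticAt 𝕜 d a ∧ s a = 1 ∧ d a = a ∧
      (∀ x, Commute p (d x)) ∧ ∀ᶠ x in 𝓝 a, x * s x = s x * d x := by
  have : CompleteSpace A := FiniteDimensional.complete 𝕜 A
  let D : A →L[𝕜] A := peirceDiagonal 𝕜 p
  let O : A →L[𝕜] A := .id 𝕜 A - D
  have hDa : D a = a := peirceDiagonal_eq_self hp (ha a (Commute.refl a))
  have hOa : O a = 0 := sub_eq_zero.2 hDa.symm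
  have hf' := hasFDerivAt_conj_one_add D O hOa
  rw [hDa] at hf'
  obtain ⟨g, hg, hga, hfg⟩ := exists_analyticAt_rightInverse (analyticAt_conj_one_add D O hOa) hf'
    (injective_peirceDiagonal_add_commutator hp ha)
  simp only [hOa, hDa, add_zero, one_mul, Ring.inverse_one, mul_one] at hg hga hfg
  have hs : AnalyticAt 𝕜 (fun x => 1 + O (g x)) a :=
    analyticAt_const.add ((O.analyticAt _).comp hg)
  have hs1 : 1 + O (g a) = 1 := by rw [hga, hOa, add_zero]
  refine ⟨fun x => 1 + O (g x), fun x => D (g x), hs, (D.analyticAt _).comp hg, hs1,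
    (congrArg D hga).trans hDa, fun x => commute_peirceDiagonal hp _, ?_⟩
  have hunit : ∀ᶠ x in 𝓝 a, IsUnit (1 + O (g x)) :=
    hs.continuousAt.eventually_mem (Units.isOpen.mem_nhds (by simp [hs1]))
  filter_upwards [hfg, hunit] with x hx hu
  nth_rw 1 [← hx]
  rw [mul_assoc, Ring.inverse_mul_cancel _ hu, mul_one]

end BlockDiagonalization

section SymmetricAlong

variable {V W : Type*} [NormedAddCommGroup V] [NormedSpace ℂ V] [NormedAddCommGroup W]
  [InnerProductSpace ℂ W] {J : V →L[ℂ] W} {T T' : V →L[ℂ] V} {c : ℂ}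

/-- `T` is symmetric for the sesquilinear form `⟪J u, J v⟫` pulled back along `J`; for injective `J`
this form is an inner product on `V`. -/
def IsSymmetricAlong (J : V →L[ℂ] W) (T : V →L[ℂ] V) : Prop :=
  ∀ u v, inner ℂ (J (T u)) (J v) = inner ℂ (J u) (J (T v))

namespace IsSymmetricAlong

lemma one : IsSymmetricAlong J 1 := fun _ _ => rfl

lemma add (hT : IsSymmetricAlong J T) (hT' : IsSymmetricAlong J T') :
    IsSymmetricAlong J (T + T') := fun u v => by
  simp only [add_apply, map_add, inner_add_left, inner_add_right, hT u v, hT' u v]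

lemma sub (hT : IsSymmetricAlong J T) (hT' : IsSymmetricAlong J T') :
    IsSymmetricAlong J (T - T') := fun u v => by
  simp only [sub_apply, map_sub, inner_sub_left, inner_sub_right, hT u v, hT' u v]

lemma smul (hT : IsSymmetricAlong J T) (hc : conj c = c) : IsSymmetricAlong J (c • T) :=
  fun u v => by
    simp only [smul_apply, map_smul, inner_smul_left, inner_smul_right, hT u v, hc]

lemma conj_eigenvalue (hT : IsSymmetricAlong J T) (hJ : Function.Injective J)
    (hc : Module.End.HasEigenvalue (T : V →ₗ[ℂ] V) c) : conj c = c := by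
  obtain ⟨u, hu⟩ := hc.exists_hasEigenvector
  have hTu : T u = c • u := hu.apply_eq_smul
  have hJu : inner ℂ (J u) (J u) ≠ 0 :=
    inner_self_ne_zero.2 ((map_ne_zero_iff J hJ).2 hu.2)
  have h := hT u u
  simp only [hTu, map_smul, inner_smul_left, inner_smul_right] at h
  exact mul_right_cancel₀ hJu h

lemma conj_trace [FiniteDimensional ℂ V] (hT : IsSymmetricAlong J T) (hJ : Function.Injective J) :
    conj (LinearMap.trace ℂ V T) = LinearMap.trace ℂ V T := by
  rw [Module.End.trace_eq_sum_roots_charpoly_of_splits (IsAlgClosed.splits _), map_multiset_sum]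
  congr 1
  refine (Multiset.map_congr rfl fun c hc => ?_).trans (Multiset.map_id _)
  exact hT.conj_eigenvalue hJ
    ((Module.End.hasEigenvalue_iff_isRoot_charpoly _ c).2 (Polynomial.isRoot_of_mem_roots hc))

lemma isCompl_ker_range [FiniteDimensional ℂ V] (hT : IsSymmetricAlong J T)
    (hJ : Function.Injective J) :
    IsCompl T.ker T.range := by
  have hdisj : Disjoint T.ker T.range := by
    refine Submodule.disjoint_def.2 ?_
    rintro _ hker ⟨v, rfl⟩
    have hTTv : T (T v) = 0 := hker
    refine (map_eq_zero_iff J hJ).1 (inner_self_eq_zero (𝕜 := ℂ).1 ?_)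
    change inner ℂ (J (T v)) (J (T v)) = 0
    rw [hT, hTTv, map_zero, inner_zero_right]
  exact (Submodule.isCompl_iff_disjoint _ _
    (by rw [add_comm, LinearMap.finrank_range_add_finrank_ker])).2 hdisj

lemma isClosed : IsClosed {P : (V →L[ℂ] W) × (V →L[ℂ] V) | IsSymmetricAlong P.1 P.2} := by
  simp only [IsSymmetricAlong, Set.ofPred_forall]
  exact isClosed_iInter fun u => isClosed_iInter fun v => isClosed_eq (by fun_prop) (by fun_prop)

end IsSymmetricAlong

end SymmetricAlong

section Rellich

lemma analyticAt_clm_comp {𝕜 X E F G : Type*} [NontriviallyNormedField 𝕜]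
    [NormedAddCommGroup X] [NormedSpace 𝕜 X] [NormedAddCommGroup E] [NormedSpace 𝕜 E]
    [NormedAddCommGroup F] [NormedSpace 𝕜 F] [NormedAddCommGroup G] [NormedSpace 𝕜 G]
    {g : X → F →L[𝕜] G} {f : X → E →L[𝕜] F} {x : X} (hg : AnalyticAt 𝕜 g x)
    (hf : AnalyticAt 𝕜 f x) : AnalyticAt 𝕜 (fun y => (g y).comp (f y)) x :=
  ((ContinuousLinearMap.compL 𝕜 E F G).analyticAt_bilinear _).comp₂ hg hf

lemma analyticAt_clm_apply {𝕜 X E F : Type*} [NontriviallyNormedField 𝕜]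
    [NormedAddCommGroup X] [NormedSpace 𝕜 X] [NormedAddCommGroup E] [NormedSpace 𝕜 E]
    [NormedAddCommGroup F] [NormedSpace 𝕜 F]
    {g : X → E →L[𝕜] F} {f : X → E} {x : X} (hg : AnalyticAt 𝕜 g x)
    (hf : AnalyticAt 𝕜 f x) : AnalyticAt 𝕜 (fun y => g y (f y)) x :=
  ((ContinuousLinearMap.id 𝕜 (E →L[𝕜] F)).analyticAt_bilinear _).comp₂ hg hf

lemma tendsto_ofReal_nhdsNE_zero : Tendsto (fun x : ℝ => (x : ℂ)) (𝓝[≠] 0) (𝓝[≠] 0) :=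
  (Complex.continuous_ofReal.tendsto' 0 0 Complex.ofReal_zero).inf
    (by simp)

variable {V W : Type*} [NormedAddCommGroup V] [NormedSpace ℂ V] [NormedAddCommGroup W]
  [InnerProductSpace ℂ W]

/-- The germ at `0` of `T` has analytic eigenvectors which form a basis at `0` (and hence near
`0`), with analytic eigenvalues. -/
def HasAnalyticEigenbasis (T : ℂ → V →L[ℂ] V) : Prop :=
  ∃ (ι : Type) (b : Module.Basis ι ℂ V) (μ : ι → ℂ → ℂ) (v : ι → ℂ → V),
    ∀ i, AnalyticAt ℂ (μ i) 0 ∧ AnalyticAt ℂ (v i) 0 ∧ v i 0 = b i ∧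
      ∀ᶠ z in 𝓝 0, T z (v i z) = μ i z • v i z

section

variable {T T' : ℂ → V →L[ℂ] V} {E F : Submodule ℂ V} {c τ : ℂ → ℂ}
  {J : ℂ → V →L[ℂ] W}

lemma HasAnalyticEigenbasis.of_eventuallyEq_add_smul (h : HasAnalyticEigenbasis T')
    (hτ : AnalyticAt ℂ τ 0) (hc : AnalyticAt ℂ c 0)
    (hT : ∀ᶠ z in 𝓝 0, T z = τ z • 1 + c z • T' z) : HasAnalyticEigenbasis T := by
  obtain ⟨ι, b, μ, v, h⟩ := h
  refine ⟨ι, b, fun i z => τ z + c z * μ i z, v, fun i => ?_⟩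
  obtain ⟨hμ, hv, hvb, hμv⟩ := h i
  refine ⟨hτ.add (hc.mul hμ), hv, hvb, ?_⟩
  filter_upwards [hT, hμv] with z hTz hz
  simp [hTz, hz, add_smul, mul_smul]

lemma HasAnalyticEigenbasis.of_isCompl (hEF : IsCompl E F)
    {S : ℂ → E →L[ℂ] V} {L : ℂ → E →L[ℂ] E} {S' : ℂ → F →L[ℂ] V} {L' : ℂ → F →L[ℂ] F}
    (hS : AnalyticAt ℂ S 0) (hS' : AnalyticAt ℂ S' 0) (hS0 : S 0 = E.subtypeL)
    (hS'0 : S' 0 = F.subtypeL) (hTS : ∀ᶠ z in 𝓝 0, ∀ u, T z (S z u) = S z (L z u))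
    (hTS' : ∀ᶠ z in 𝓝 0, ∀ u, T z (S' z u) = S' z (L' z u))
    (hL : HasAnalyticEigenbasis L) (hL' : HasAnalyticEigenbasis L') : HasAnalyticEigenbasis T := by
  obtain ⟨ι, b, μ, v, h⟩ := hL
  obtain ⟨ι', b', μ', v', h'⟩ := hL'
  refine ⟨ι ⊕ ι', (b.prod b').map (Submodule.prodEquivOfIsCompl E F hEF), Sum.elim μ μ',
    Sum.elim (fun i z => S z (v i z)) (fun i z => S' z (v' i z)), Sum.rec (fun i => ?_) fun i => ?_⟩
  · obtain ⟨hμ, hv, hvb, hμv⟩ := h i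
    refine ⟨hμ, analyticAt_clm_apply hS hv, by simp [hS0, hvb], ?_⟩
    filter_upwards [hTS, hμv] with z hz hz'
    simp [hz, hz']
  · obtain ⟨hμ, hv, hvb, hμv⟩ := h' i
    refine ⟨hμ, analyticAt_clm_apply hS' hv, by simp [hS'0, hvb], ?_⟩
    filter_upwards [hTS', hμv] with z hz hz'
    simp [hz, hz']

/-- The family `T` is analytic at `0` and, at the real points near `0`, symmetric for the inner
product pulled back along `J`. Letting `J` vary makes the notion stable under restriction to a
moving invariant subspace, parametrised by a fixed one. -/
structure IsSymmetricGerm (J : ℂ → V →L[ℂ] W) (T : ℂ → V →L[ℂ] V) : Prop where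
  analyticAt : AnalyticAt ℂ T 0
  continuousAt : ContinuousAt J 0
  injective : Function.Injective (J 0)
  eventually_symmetric : ∀ᶠ x : ℝ in 𝓝[≠] 0, IsSymmetricAlong (J x) (T x)

lemma IsSymmetricGerm.isSymmetricAlong_zero (h : IsSymmetricGerm J T) :
    IsSymmetricAlong (J 0) (T 0) :=
  IsSymmetricAlong.isClosed.mem_of_tendsto
    (((h.continuousAt.prodMk h.analyticAt.continuousAt).tendsto.mono_left
      nhdsWithin_le_nhds).comp tendsto_ofReal_nhdsNE_zero) h.eventually_symmetric

variable [FiniteDimensional ℂ V]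

lemma hasAnalyticEigenbasis_zero : HasAnalyticEigenbasis (fun _ => (0 : V →L[ℂ] V)) :=
  ⟨_, Module.finBasis ℂ V, 0, fun i _ => Module.finBasis ℂ V i,
    fun _ => ⟨analyticAt_const, analyticAt_const, rfl, by simp⟩⟩

lemma exists_analytic_restriction (hT : AnalyticAt ℂ T 0) (hEF : IsCompl E F)
    (hinv : ∀ y : V →L[ℂ] V, Commute y (T 0) → Set.MapsTo y E E ∧ Set.MapsTo y F F) :
    ∃ (S : ℂ → E →L[ℂ] V) (L : ℂ → E →L[ℂ] E), AnalyticAt ℂ S 0 ∧ AnalyticAt ℂ L 0 ∧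
      S 0 = E.subtypeL ∧ ∀ᶠ z in 𝓝 0, ∀ u, T z (S z u) = S z (L z u) := by
  let π : V →L[ℂ] E := (E.projectionOnto F hEF).toContinuousLinearMap
  let p : V →L[ℂ] V := E.subtypeL.comp π
  have hpE (u : E) : p u = u := E.projection_apply_left hEF u
  have hpF (u : F) : p u = 0 := E.projection_apply_right hEF u
  have hp : IsIdempotentElem p := ContinuousLinearMap.ext fun x => hpE (π x)
  have hcomm (y : V →L[ℂ] V) (hy : Commute y (T 0)) : Commute y p := by
    refine ContinuousLinearMap.ext fun x => ?_
    obtain ⟨hyE, hyF⟩ := hinv y hy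
    obtain ⟨u, v, rfl, -⟩ := Submodule.existsUnique_add_of_isCompl hEF x
    have hyu : p (y u) = y u := hpE ⟨y u, hyE u.2⟩
    have hyv : p (y v) = 0 := hpF ⟨y v, hyF v.2⟩
    simp only [mul_apply_eq_comp, map_add, hpE, hpF, hyu, hyv, map_zero]
  obtain ⟨s, d, hs, hd, hs0, -, hdp, hsd⟩ :=
    exists_analyticAt_blockDiagonalization (𝕜 := ℂ) hp hcomm
  refine ⟨fun z => (s (T z)).comp E.subtypeL, fun z => π.comp ((d (T z)).comp E.subtypeL),
    analyticAt_clm_comp (hs.comp hT) analyticAt_const,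
    analyticAt_clm_comp analyticAt_const (analyticAt_clm_comp (hd.comp hT) analyticAt_const),
    by simp only [hs0]; rfl, ?_⟩
  filter_upwards [hT.continuousAt.eventually hsd] with z hz u
  have hdu : d (T z) u = p (d (T z) u) := by
    rw [← mul_apply_eq_comp, (hdp _).eq, mul_apply_eq_comp]
    simp [p, π]
  calc T z (s (T z) u) = (s (T z)) (d (T z) u) := congr($hz u)
    _ = _ := by rw [hdu]; rfl

lemma exists_eventually_eq_add_pow_smul (hT : AnalyticAt ℂ T 0) :
    (∃ τ : ℂ → ℂ, AnalyticAt ℂ τ 0 ∧ ∀ᶠ z in 𝓝 0, T z = τ z • 1) ∨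
    ∃ (τ : ℂ → ℂ) (r : ℕ) (T₁ : ℂ → V →L[ℂ] V), AnalyticAt ℂ τ 0 ∧ AnalyticAt ℂ T₁ 0 ∧
      (∀ z, τ z = (Module.finrank ℂ V : ℂ)⁻¹ * LinearMap.trace ℂ V (T z)) ∧
      (∀ c : ℂ, T₁ 0 ≠ c • 1) ∧ ∀ᶠ z in 𝓝 0, T z = τ z • 1 + z ^ r • T₁ z := by
  let tr : (V →L[ℂ] V) →L[ℂ] ℂ :=
    (LinearMap.trace ℂ V ∘ₗ ContinuousLinearMap.coeLM ℂ).toContinuousLinearMap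
  let τ : ℂ → ℂ := fun z => (Module.finrank ℂ V : ℂ)⁻¹ * tr (T z)
  have hτ : AnalyticAt ℂ τ 0 := analyticAt_const.mul ((tr.analyticAt _).comp hT)
  by_cases hscalar : ∀ᶠ z in 𝓝 0, T z - τ z • 1 = 0
  · exact .inl ⟨τ, hτ, hscalar.mono fun z hz => sub_eq_zero.1 hz⟩
  obtain ⟨r, T₁, hT₁, hT₁0, hTT₁⟩ :=
    (hT.sub (hτ.smul analyticAt_const)).exists_eventuallyEq_pow_smul_nonzero_iff.2 hscalar
  simp only [Pi.sub_apply, Pi.smul_apply', sub_zero] at hTT₁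
  refine .inr ⟨τ, r, T₁, hτ, hT₁, fun z => rfl, fun c hc => ?_,
    hTT₁.mono fun z hz => by rw [← hz, add_sub_cancel]⟩
  have hdim : (Module.finrank ℂ V : ℂ) ≠ 0 := by
    obtain ⟨x, hx⟩ := DFunLike.ne_iff.1 hT₁0
    have := nontrivial_of_ne _ _ hx
    exact Nat.cast_ne_zero.2 Module.finrank_pos.ne'
  have htr1 : tr 1 = Module.finrank ℂ V := LinearMap.trace_one ℂ V
  have htr : ∀ᶠ z in 𝓝[≠] 0, tr (T₁ z) = 0 := by
    filter_upwards [hTT₁.filter_mono nhdsWithin_le_nhds, self_mem_nhdsWithin] with z hz hz0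
    have h := congrArg tr hz
    rw [map_sub, map_smul, map_smul, htr1, smul_eq_mul, smul_eq_mul, mul_right_comm,
      inv_mul_cancel₀ hdim, one_mul, sub_self] at h
    exact (mul_eq_zero.1 h.symm).resolve_left (pow_ne_zero r hz0)
  have htr0 : tr (T₁ 0) = 0 :=
    tendsto_nhds_unique_of_eventuallyEq
      ((tr.continuous.continuousAt.comp hT₁.continuousAt).mono_left nhdsWithin_le_nhds)
      tendsto_const_nhds htr
  rw [hc, map_smul, htr1, smul_eq_mul, mul_eq_zero, or_iff_left hdim] at htr0
  exact hT₁0 (by rw [hc, htr0, zero_smul])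

namespace IsSymmetricGerm

lemma of_eventually_eq_add_pow_smul (h : IsSymmetricGerm J T) {T₁ : ℂ → V →L[ℂ] V} {r : ℕ}
    (hT₁ : AnalyticAt ℂ T₁ 0)
    (hτ : ∀ z, τ z = (Module.finrank ℂ V : ℂ)⁻¹ * LinearMap.trace ℂ V (T z))
    (hTT₁ : ∀ᶠ z in 𝓝 0, T z = τ z • 1 + z ^ r • T₁ z) : IsSymmetricGerm J T₁ := by
  refine ⟨hT₁, h.continuousAt, h.injective, ?_⟩
  have hinj : ∀ᶠ z in 𝓝 0, Function.Injective (J z) :=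
    h.continuousAt.eventually_mem (ContinuousLinearMap.isOpen_injective.mem_nhds h.injective)
  have hnear : 𝓝[≠] (0 : ℂ) ≤ 𝓝 0 := nhdsWithin_le_nhds
  filter_upwards [h.eventually_symmetric, self_mem_nhdsWithin,
    tendsto_ofReal_nhdsNE_zero.eventually (hTT₁.filter_mono hnear),
    tendsto_ofReal_nhdsNE_zero.eventually (hinj.filter_mono hnear)] with x hsym hx hTx hJx
  have hτx : conj (τ x) = τ x := by simp [hτ, hsym.conj_trace hJx]
  have hT₁x : T₁ x = ((x : ℂ) ^ r)⁻¹ • (T x - τ x • 1) := by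
    rw [hTx, add_sub_cancel_left, inv_smul_smul₀ (pow_ne_zero r (Complex.ofReal_ne_zero.2 hx))]
  rw [hT₁x]
  exact (hsym.sub (IsSymmetricAlong.one.smul hτx)).smul (by simp)

lemma exists_restriction (h : IsSymmetricGerm J T) (hEF : IsCompl E F)
    (hinv : ∀ y : V →L[ℂ] V, Commute y (T 0) → Set.MapsTo y E E ∧ Set.MapsTo y F F) :
    ∃ (S : ℂ → E →L[ℂ] V) (L : ℂ → E →L[ℂ] E), AnalyticAt ℂ S 0 ∧ S 0 = E.subtypeL ∧
      (∀ᶠ z in 𝓝 0, ∀ u, T z (S z u) = S z (L z u)) ∧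
      IsSymmetricGerm (fun z => (J z).comp (S z)) L := by
  obtain ⟨S, L, hS, hL, hS0, hTS⟩ := exists_analytic_restriction h.analyticAt hEF hinv
  refine ⟨S, L, hS, hS0, hTS, hL, h.continuousAt.clm_comp hS.continuousAt, ?_, ?_⟩
  · rw [hS0]
    exact h.injective.comp Subtype.val_injective
  · filter_upwards [h.eventually_symmetric, tendsto_ofReal_nhdsNE_zero.eventually
      (hTS.filter_mono nhdsWithin_le_nhds)] with x hsym hx u v
    simp only [ContinuousLinearMap.comp_apply, ← hx]
    exact hsym (S x u) (S x v)

lemma exists_isCompl (h : IsSymmetricGerm J T) (hscalar : ∀ c : ℂ, T 0 ≠ c • 1) :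
    ∃ E F : Submodule ℂ V, IsCompl E F ∧ E ≠ ⊤ ∧ F ≠ ⊤ ∧
      ∀ y : V →L[ℂ] V, Commute y (T 0) → Set.MapsTo y E E ∧ Set.MapsTo y F F := by
  obtain ⟨x, hx⟩ := DFunLike.ne_iff.1 (hscalar 0)
  have := nontrivial_of_ne _ _ hx
  obtain ⟨c, hc⟩ := Module.End.exists_eigenvalue (T 0 : V →ₗ[ℂ] V)
  have hcc := h.isSymmetricAlong_zero.conj_eigenvalue h.injective hc
  let D : V →L[ℂ] V := T 0 - c • 1
  have hD : IsSymmetricAlong (J 0) D := h.isSymmetricAlong_zero.sub (IsSymmetricAlong.one.smul hcc)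
  obtain ⟨u, hu⟩ := hc.exists_hasEigenvector
  have hDu : D u = 0 := by simpa [D, sub_eq_zero] using hu.apply_eq_smul
  have hcompl := hD.isCompl_ker_range h.injective
  refine ⟨D.ker, D.range, hcompl, fun htop => hscalar c ?_, fun htop => hu.2 ?_, fun y hy => ?_⟩
  · refine ContinuousLinearMap.ext fun x => ?_
    have hx : x ∈ D.ker := htop ▸ Submodule.mem_top
    exact sub_eq_zero.1 hx
  · exact Submodule.disjoint_def.1 hcompl.disjoint u hDu (htop ▸ Submodule.mem_top)
  · have hyD (x : V) : y (D x) = D (y x) := by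
      simpa [D] using congr($hy x)
    refine ⟨fun x hx => ?_, ?_⟩
    · have hDx : D x = 0 := hx
      change D (y x) = 0
      rw [← hyD, hDx, map_zero]
    · rintro _ ⟨x, rfl⟩
      exact ⟨y x, (hyD x).symm⟩

end IsSymmetricGerm

end

theorem IsSymmetricGerm.hasAnalyticEigenbasis [FiniteDimensional ℂ V] {J : ℂ → V →L[ℂ] W}
    {T : ℂ → V →L[ℂ] V} (h : IsSymmetricGerm J T) : HasAnalyticEigenbasis T := by
  induction hn : Module.finrank ℂ V using Nat.strong_induction_on generalizing V with
  | h n ih =>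
  have hzero : AnalyticAt ℂ (0 : ℂ → ℂ) 0 := analyticAt_const
  obtain ⟨τ, hτ, hT⟩ | ⟨τ, r, T₁, hτ, hT₁, hτtr, hscalar, hT⟩ :=
    exists_eventually_eq_add_pow_smul h.analyticAt
  · exact hasAnalyticEigenbasis_zero.of_eventuallyEq_add_smul hτ hzero (by simpa using hT)
  have h₁ := h.of_eventually_eq_add_pow_smul hT₁ hτtr hT
  obtain ⟨E, F, hEF, hE, hF, hinv⟩ := h₁.exists_isCompl hscalar
  obtain ⟨S, L, hS, hS0, hTS, hL⟩ := h₁.exists_restriction hEF hinv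
  obtain ⟨S', L', hS', hS'0, hTS', hL'⟩ :=
    h₁.exists_restriction hEF.symm fun y hy => (hinv y hy).symm
  have hT₁b : HasAnalyticEigenbasis T₁ := .of_isCompl hEF hS hS' hS0 hS'0 hTS hTS'
    (ih _ (hn ▸ Submodule.finrank_lt hE) hL rfl) (ih _ (hn ▸ Submodule.finrank_lt hF) hL' rfl)
  exact hT₁b.of_eventuallyEq_add_smul hτ (analyticAt_id.pow r) hT

end Rellich

section HermitianPencil

lemma IsSymmetricAlong.hasAnalyticEigenbasis_add_smul {V W : Type*} [NormedAddCommGroup V]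
    [NormedSpace ℂ V] [FiniteDimensional ℂ V] [NormedAddCommGroup W] [InnerProductSpace ℂ W]
    {J : V →L[ℂ] W} {T T' : V →L[ℂ] V} (hJ : Function.Injective J) (hT : IsSymmetricAlong J T)
    (hT' : IsSymmetricAlong J T') : HasAnalyticEigenbasis fun z => T + z • T' :=
  IsSymmetricGerm.hasAnalyticEigenbasis (J := fun _ => J)
    ⟨analyticAt_const.add (analyticAt_id.smul analyticAt_const), continuousAt_const, hJ,
      .of_forall fun x => hT.add (hT'.smul (Complex.conj_ofReal x))⟩

variable {ι : Type*} [Fintype ι]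

lemma isSymmetricAlong_toContinuousLinearMap_mulVecLin {M : Matrix ι ι ℂ} (hM : M.IsHermitian) :
    IsSymmetricAlong ((EuclideanSpace.equiv ι ℂ).symm : (ι → ℂ) →L[ℂ] EuclideanSpace ℂ ι)
      M.mulVecLin.toContinuousLinearMap := fun u v => by
  change v ⬝ᵥ star (M *ᵥ u) = (M *ᵥ v) ⬝ᵥ star u
  rw [Matrix.star_mulVec, hM.eq, dotProduct_comm, ← Matrix.dotProduct_mulVec, dotProduct_comm]

theorem exists_analytic_eigenbasis_of_isHermitian {M M' : Matrix ι ι ℂ} (hM : M.IsHermitian)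
    (hM' : M'.IsHermitian) :
    ∃ (b : Module.Basis ι ℂ (ι → ℂ)) (μ : ι → ℂ → ℂ) (v : ι → ℂ → ι → ℂ),
      ∀ i, AnalyticAt ℂ (μ i) 0 ∧ AnalyticAt ℂ (v i) 0 ∧ v i 0 = b i ∧
        ∀ᶠ z in 𝓝 0, (M + z • M') *ᵥ v i z = μ i z • v i z := by
  obtain ⟨κ, b, μ, v, h⟩ :=
    (isSymmetricAlong_toContinuousLinearMap_mulVecLin hM).hasAnalyticEigenbasis_add_smul
      (EuclideanSpace.equiv ι ℂ).symm.injective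
      (isSymmetricAlong_toContinuousLinearMap_mulVecLin hM')
  let e : κ ≃ ι := b.indexEquiv (Pi.basisFun ℂ ι)
  refine ⟨b.reindex e, fun i => μ (e.symm i), fun i => v (e.symm i), fun i => ?_⟩
  obtain ⟨hμ, hv, hvb, heig⟩ := h (e.symm i)
  refine ⟨hμ, hv, hvb.trans (b.reindex_apply e i).symm, heig.mono fun z hz => ?_⟩
  rwa [Matrix.add_mulVec, Matrix.smul_mulVec]

end HermitianPencil

section CharacteristicPolynomial

open Polynomial

variable {n K : Type*} [Fintype n] [DecidableEq n] [Field K]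

lemma charpoly_eq_prod_of_eigenbasis {κ : Type*} [Fintype κ] {M : Matrix n n K} {μ : κ → K}
    (b : Module.Basis κ K (n → K)) (hb : ∀ i, M *ᵥ b i = μ i • b i) :
    M.charpoly = ∏ i, (X - C (μ i)) := by
  classical
  have hM : M.toLin' = Matrix.toLin b b (Matrix.diagonal μ) :=
    b.ext fun i => by simp [hb, Matrix.toLin_self, Matrix.diagonal_apply, ite_smul]
  rw [← Matrix.charpoly_toLin', hM, Matrix.charpoly_toLin, Matrix.charpoly_diagonal]

lemma roots_prod_univ_X_sub_C {κ : Type*} [Fintype κ] (μ : κ → K) :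
    (∏ i, (X - C (μ i))).roots = Finset.univ.val.map μ := by
  have hroots := roots_multiset_prod_X_sub_C (Finset.univ.val.map μ)
  rwa [Multiset.map_map] at hroots

lemma det_one_sub_smul_eq_prod_roots [IsAlgClosed K] (M : Matrix n n K) (t : K) :
    (1 - t • M).det = (M.charpoly.roots.map fun x => 1 - t * x).prod := by
  obtain rfl | ht := eq_or_ne t 0
  · simp
  have hsplits := IsAlgClosed.splits M.charpoly
  have hcard : M.charpoly.roots.card = Fintype.card n := by
    rw [← hsplits.natDegree_eq_card_roots, Matrix.charpoly_natDegree_eq_dim]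
  have hM : 1 - t • M = t • (Matrix.scalar n t⁻¹ - M) := by
    rw [smul_sub, Matrix.scalar_apply, ← Matrix.smul_one_eq_diagonal, smul_inv_smul₀ ht]
  rw [hM, Matrix.det_smul, ← Matrix.eval_charpoly,
    hsplits.eval_eq_prod_roots_of_monic M.charpoly_monic, ← hcard, ← Multiset.prod_replicate,
    ← Multiset.map_const', ← Multiset.prod_map_mul]
  simp only [mul_sub, mul_inv_cancel₀ ht]

end CharacteristicPolynomial

section Complexification

variable {l m n : Type*}

lemma complexify_eq_map (M : Matrix m n ℝ) : complexify M = M.map (algebraMap ℝ ℂ) := rfl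

lemma complexify_mul [Fintype m] (M : Matrix l m ℝ) (M' : Matrix m n ℝ) :
    complexify (M * M') = complexify M * complexify M' :=
  Matrix.map_mul (f := algebraMap ℝ ℂ)

lemma complexify_transpose (M : Matrix m n ℝ) : complexify Mᵀ = (complexify M)ᵀ := rfl

lemma conjTranspose_complexify (M : Matrix m n ℝ) : (complexify M)ᴴ = complexify Mᵀ := by
  ext i j
  simp [complexify]

lemma complexify_neg (M : Matrix m n ℝ) : complexify (-M) = -complexify M := by
  ext i j
  simp [complexify]

lemma complexify_one [DecidableEq n] : complexify (1 : Matrix n n ℝ) = 1 := by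
  simp [complexify]

lemma det_complexify [Fintype n] [DecidableEq n] (M : Matrix n n ℝ) :
    (complexify M).det = (M.det : ℂ) :=
  (RingHom.map_det (algebraMap ℝ ℂ) M).symm

end Complexification

section NonzeroEigenvalues

variable {N r : ℕ} {M : Matrix (Fin N) (Fin N) ℝ} {b : Fin r → ℝ}

lemma exists_monotone_univ_val_map_eq {β : Type*} [LinearOrder β] (s : Multiset β) :
    ∃ b : Fin s.card → β, Monotone b ∧ Finset.univ.val.map b = s := by
  have hlength : s.card = (s.sort (· ≤ ·)).length := (Multiset.length_sort _).symm
  refine ⟨fun k => (s.sort (· ≤ ·)).get (k.cast hlength),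
    (s.pairwise_sort (· ≤ ·)).sortedLE.monotone_get.comp (Fin.cast_strictMono hlength).monotone, ?_⟩
  rw [Fin.univ_val_map, List.ofFn_congr hlength]
  exact (congrArg _ (List.ofFn_get _)).trans (s.sort_eq _)

lemma exists_listsNonzeroEigenvalues_of_posSemidef (hM : M.PosSemidef) :
    ∃ b : Fin M.rank → ℝ, ListsNonzeroEigenvalues M b ∧ ∀ k, 0 < b k := by
  classical
  have hH := hM.isHermitian
  have hroots : M.charpoly.roots = Finset.univ.val.map hH.eigenvalues :=
    hH.roots_charpoly_eq_eigenvalues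
  obtain ⟨b, hb, hbM⟩ := exists_monotone_univ_val_map_eq (M.charpoly.roots.filter (· ≠ 0))
  have hcard : (M.charpoly.roots.filter (· ≠ 0)).card = M.rank := by
    rw [hH.rank_eq_card_non_zero_eigs, hroots, Multiset.filter_map, Multiset.card_map,
      Fintype.card_subtype]
    rfl
  rw [← hcard]
  refine ⟨b, ⟨hb, ?_⟩, fun k => ?_⟩
  · rw [complexify_eq_map, Matrix.charpoly_map, hH.splits_charpoly.roots_map, Multiset.filter_map]
    have hne : (fun x : ℂ => x ≠ 0) ∘ algebraMap ℝ ℂ = fun x : ℝ => x ≠ 0 :=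
      funext fun x => propext (map_ne_zero (algebraMap ℝ ℂ))
    simp only [hne, ← hbM, Multiset.map_map]
    rfl
  · have hk : b k ∈ M.charpoly.roots.filter (· ≠ 0) :=
      hbM ▸ Multiset.mem_map_of_mem b (Finset.mem_univ k)
    rw [Multiset.mem_filter, hroots, Multiset.mem_map] at hk
    obtain ⟨⟨i, -, hi⟩, hk0⟩ := hk
    exact (hi ▸ hM.eigenvalues_nonneg i).lt_of_ne' hk0

lemma ListsNonzeroEigenvalues.det_one_sub_smul (hb : ListsNonzeroEigenvalues M b) (t : ℂ) :
    (1 - t • complexify M).det = ∏ k, (1 - t * b k) := by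
  have hzero : ((complexify M).charpoly.roots.filter fun x => ¬x ≠ 0).map (1 - t * ·) =
      ((complexify M).charpoly.roots.filter fun x => ¬x ≠ 0).map fun _ => 1 :=
    Multiset.map_congr rfl fun x hx => by
      rw [not_not.1 (Multiset.mem_filter.1 hx).2, mul_zero, sub_zero]
  rw [det_one_sub_smul_eq_prod_roots, ← Multiset.filter_add_not (· ≠ 0) (Matrix.charpoly _).roots,
    Multiset.map_add, Multiset.prod_add, hzero, Multiset.prod_map_one, mul_one, ← hb.2,
    Multiset.map_map]
  rfl

lemma ListsNonzeroEigenvalues.card_filter_roots (hb : ListsNonzeroEigenvalues M b) :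
    ((complexify M).charpoly.roots.filter (· ≠ 0)).card = r := by
  rw [← hb.2, Multiset.card_map, Finset.card_val, Finset.card_univ, Fintype.card_fin]

end NonzeroEigenvalues

section SystemOperator

variable {N : ℕ} {α η θ R : Matrix (Fin N) (Fin N) ℝ}

lemma Kq_mul_self (hη : η.PosDef) : Kq η * Kq η = η :=
  CFC.sqrt_mul_sqrt_self η hη.posSemidef.nonneg

lemma Kq_transpose (η : Matrix (Fin N) (Fin N) ℝ) : (Kq η)ᵀ = Kq η :=
  (Matrix.conjTranspose_eq_transpose_of_trivial _).symm.trans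
    (Matrix.nonneg_iff_posSemidef.1 (CFC.sqrt_nonneg η)).isHermitian

lemma Kp_eq_inv_Kq (α : Matrix (Fin N) (Fin N) ℝ) : Kp α = (Kq α)⁻¹ := rfl

lemma Kp_transpose (α : Matrix (Fin N) (Fin N) ℝ) : (Kp α)ᵀ = Kp α := by
  rw [Kp_eq_inv_Kq, Matrix.transpose_nonsing_inv, Kq_transpose]

lemma Kp_mul_self (hα : α.PosDef) : Kp α * Kp α = α⁻¹ := by
  rw [Kp_eq_inv_Kq, ← Matrix.mul_inv_rev, Kq_mul_self hα]

lemma isUnit_det_Kq (hα : α.PosDef) : IsUnit (Kq α).det := by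
  have h := hα.isUnit
  rw [Matrix.isUnit_iff_isUnit_det, ← Kq_mul_self hα, Matrix.det_mul] at h
  exact isUnit_of_mul_isUnit_left h

lemma isUnit_det_Kp (hα : α.PosDef) : IsUnit (Kp α).det :=
  Matrix.isUnit_nonsing_inv_det _ (isUnit_det_Kq hα)

lemma Kp_mul_mul_Kp_transpose (hα : α.PosDef) : Kp α * α * (Kp α)ᵀ = 1 := by
  have hKq := isUnit_det_Kq hα
  nth_rw 2 [← Kq_mul_self hα]
  rw [Kp_transpose, Kp_eq_inv_Kq, Matrix.nonsing_inv_mul_cancel_left _ _ hKq,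
    Matrix.mul_nonsing_inv _ hKq]

lemma rank_Kp_mul_mul_Kp_transpose (hα : α.PosDef) (R : Matrix (Fin N) (Fin N) ℝ) :
    (Kp α * R * (Kp α)ᵀ).rank = R.rank := by
  rw [Kp_transpose, Matrix.rank_mul_eq_left_of_isUnit_det _ _ (isUnit_det_Kp hα),
    Matrix.rank_mul_eq_right_of_isUnit_det _ _ (isUnit_det_Kp hα)]

lemma posSemidef_Kp_mul_mul_Kp_transpose (α : Matrix (Fin N) (Fin N) ℝ) (hR : R.PosSemidef) :
    (Kp α * R * (Kp α)ᵀ).PosSemidef := by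
  rw [← Matrix.conjTranspose_eq_transpose_of_trivial]
  exact hR.mul_mul_conjTranspose_same (Kp α)

lemma Phi_transpose_mul_Phi (α : Matrix (Fin N) (Fin N) ℝ) (hη : η.PosDef) :
    (Phi α η)ᵀ * Phi α η = Kp α * η * (Kp α)ᵀ := by
  rw [Phi, Matrix.transpose_mul, Matrix.transpose_transpose, Kq_transpose]
  nth_rw 3 [← Kq_mul_self hη]
  simp only [mul_assoc]

lemma exists_listsNonzeroEigenvalues_inv_mul (hη : η.PosDef) (hR : R.PosSemidef) :
    ∃ b : Fin R.rank → ℝ, ListsNonzeroEigenvalues (η⁻¹ * R) b ∧ ∀ k, 0 < b k := by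
  have h := exists_listsNonzeroEigenvalues_of_posSemidef (posSemidef_Kp_mul_mul_Kp_transpose η hR)
  rw [rank_Kp_mul_mul_Kp_transpose hη] at h
  have hcharpoly :
      (complexify (Kp η * R * (Kp η)ᵀ)).charpoly = (complexify (η⁻¹ * R)).charpoly := by
    rw [complexify_mul, Matrix.charpoly_mul_comm, ← complexify_mul, Kp_transpose, ← mul_assoc,
      Kp_mul_self hη]
  simpa only [ListsNonzeroEigenvalues, hcharpoly] using h

lemma isHermitian_frequencyOperator (α η : Matrix (Fin N) (Fin N) ℝ) (hθ : θᵀ = -θ) :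
    (frequencyOperator α η θ).IsHermitian := by
  have hskew : (Kp α * θ * (Kp α)ᵀ)ᵀ = -(Kp α * θ * (Kp α)ᵀ) := by
    rw [Matrix.transpose_mul, Matrix.transpose_mul, Matrix.transpose_transpose, hθ, ← mul_assoc,
      mul_neg, neg_mul]
  rw [frequencyOperator, Matrix.IsHermitian, Matrix.fromBlocks_conjTranspose]
  simp only [Matrix.conjTranspose_smul, conjTranspose_complexify, hskew, complexify_neg,
    Matrix.transpose_transpose, Matrix.conjTranspose_zero]
  congr 1 <;> simp

lemma isHermitian_dissipationOperator (α : Matrix (Fin N) (Fin N) ℝ) (hR : R.PosSemidef) :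
    (dissipationOperator α R).IsHermitian := by
  have hsymm := (posSemidef_Kp_mul_mul_Kp_transpose α hR).isHermitian
  rw [Matrix.IsHermitian, Matrix.conjTranspose_eq_transpose_of_trivial] at hsymm
  rw [dissipationOperator, Matrix.IsHermitian, Matrix.fromBlocks_conjTranspose]
  simp only [conjTranspose_complexify, hsymm, Matrix.conjTranspose_zero]

lemma card_filter_roots_charpoly_dissipationOperator (hα : α.PosDef) (hR : R.PosSemidef) :
    ((dissipationOperator α R).charpoly.roots.filter (· ≠ 0)).card = R.rank := by
  obtain ⟨b, hb, -⟩ :=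
    exists_listsNonzeroEigenvalues_of_posSemidef (posSemidef_Kp_mul_mul_Kp_transpose α hR)
  rw [dissipationOperator, Matrix.charpoly_fromBlocks_zero₁₂, Polynomial.roots_mul,
    Multiset.filter_add, Multiset.card_add, hb.card_filter_roots, rank_Kp_mul_mul_Kp_transpose hα]
  · simp [Multiset.filter_nsmul, Multiset.filter_singleton]
  · exact ((Matrix.charpoly_monic _).mul (Matrix.charpoly_monic _)).ne_zero

lemma scalar_sub_systemOperator (β : ℝ) (ζ : ℂ) :
    Matrix.scalar (Fin N ⊕ Fin N) ζ - systemOperator α η θ R β =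
      Matrix.fromBlocks
        (ζ • 1 + (2 * Complex.I) • complexify (Kp α * θ * (Kp α)ᵀ) +
          (Complex.I * β) • complexify (Kp α * R * (Kp α)ᵀ))
        (Complex.I • complexify (Phi α η)ᵀ) (-(Complex.I • complexify (Phi α η))) (ζ • 1) := by
  rw [systemOperator, frequencyOperator, dissipationOperator, Matrix.scalar_apply,
    ← Matrix.smul_one_eq_diagonal, ← Matrix.fromBlocks_one]
  simp only [sub_eq_add_neg, Matrix.fromBlocks_smul, Matrix.fromBlocks_neg, Matrix.fromBlocks_add]
  congr 1
  · module
  · simp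
  · simp
  · simp

lemma det_fromBlocks_smul_one {n K : Type*} [Fintype n] [DecidableEq n] [Field K]
    (A B C : Matrix n n K) {c : K} (hc : c ≠ 0) :
    (Matrix.fromBlocks A B C (c • 1)).det = (c • A - B * C).det := by
  let _ : Invertible (c • (1 : Matrix n n K)) :=
    ⟨c⁻¹ • 1, by simp [smul_smul, hc], by simp [smul_smul, hc]⟩
  have hinv : ⅟(c • (1 : Matrix n n K)) = c⁻¹ • 1 := rfl
  rw [Matrix.det_fromBlocks₂₂, hinv, ← Matrix.det_mul, smul_mul_assoc, one_mul, Matrix.mul_smul,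
    mul_one, smul_sub, Matrix.smul_mul, smul_inv_smul₀ hc]

lemma complexify_Kp_mul_mul_Kp_transpose (M : Matrix (Fin N) (Fin N) ℝ) :
    complexify (Kp α * M * (Kp α)ᵀ) =
      complexify (Kp α) * complexify M * (complexify (Kp α))ᵀ := by
  rw [complexify_mul, complexify_mul, complexify_transpose]

lemma eval_charpoly_systemOperator (hα : α.PosDef) (hη : η.PosDef) (β : ℝ) {ζ : ℂ} (hζ : ζ ≠ 0) :
    (systemOperator α η θ R β).charpoly.eval ζ = ((Kp α).det : ℂ) ^ 2 *
      (ζ ^ 2 • complexify α + (Complex.I * ζ) • (2 • complexify θ + (β : ℂ) • complexify R) -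
        complexify η).det := by
  have hΦ : complexify (Phi α η)ᵀ * complexify (Phi α η) =
      complexify (Kp α) * complexify η * (complexify (Kp α))ᵀ := by
    rw [← complexify_mul, Phi_transpose_mul_Phi α hη, complexify_Kp_mul_mul_Kp_transpose]
  have hone : (1 : Matrix (Fin N) (Fin N) ℂ) =
      complexify (Kp α) * complexify α * (complexify (Kp α))ᵀ := by
    rw [← complexify_Kp_mul_mul_Kp_transpose, Kp_mul_mul_Kp_transpose hα, complexify_one]
  rw [Matrix.eval_charpoly, scalar_sub_systemOperator, det_fromBlocks_smul_one _ _ _ hζ,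
    Matrix.mul_neg, Matrix.smul_mul, Matrix.mul_smul, hΦ, smul_smul, Complex.I_mul_I, hone,
    complexify_Kp_mul_mul_Kp_transpose, complexify_Kp_mul_mul_Kp_transpose]
  set K := complexify (Kp α) with hK
  have hdet : ((Kp α).det : ℂ) ^ 2 = K.det * Kᵀ.det := by
    rw [Matrix.det_transpose, ← sq, hK, det_complexify]
  rw [hdet, mul_right_comm, ← Matrix.det_mul, ← Matrix.det_mul]
  congr 1
  simp only [Matrix.mul_sub, Matrix.sub_mul, Matrix.mul_add, Matrix.add_mul, Matrix.mul_smul,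
    Matrix.smul_mul]
  module

end SystemOperator

section AtInfinity

lemma tendsto_inv_ofReal_atTop : Tendsto (fun β : ℝ => (β : ℂ)⁻¹) atTop (𝓝[≠] 0) :=
  tendsto_inv₀_cobounded'.comp (RCLike.tendsto_ofReal_atTop_cobounded ℂ)

lemma tendsto_inv_ofReal_atTop_zero : Tendsto (fun β : ℝ => (β : ℂ)⁻¹) atTop (𝓝 0) :=
  tendsto_inv_ofReal_atTop.mono_right nhdsWithin_le_nhds

lemma eventually_ofReal_ne_zero_atTop : ∀ᶠ β : ℝ in atTop, (β : ℂ) ≠ 0 := by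
  filter_upwards [eventually_gt_atTop 0] with β hβ
  exact Complex.ofReal_ne_zero.2 hβ.ne'

lemma tendsto_ofReal_zpow_atTop_zero {n : ℤ} (hn : n < 0) :
    Tendsto (fun β : ℝ => (β : ℂ) ^ n) atTop (𝓝 0) := by
  simp only [← Complex.ofReal_zpow]
  exact (Complex.continuous_ofReal.tendsto' 0 0 Complex.ofReal_zero).comp
    (tendsto_zpow_atTop_zero hn)

lemma tendsto_comp_inv_ofReal_atTop {E : Type*} [TopologicalSpace E] {g : ℂ → E}
    (hg : ContinuousAt g 0) : Tendsto (fun β : ℝ => g (β : ℂ)⁻¹) atTop (𝓝 (g 0)) :=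
  hg.tendsto.comp tendsto_inv_ofReal_atTop_zero

lemma exists_analyticAt_eq_mul {f : ℂ → ℂ} (hf : AnalyticAt ℂ f 0) (h0 : f 0 = 0) :
    ∃ g : ℂ → ℂ, AnalyticAt ℂ g 0 ∧ ∀ᶠ z in 𝓝 0, f z = z * g z := by
  have horder : ((1 : ℕ) : ℕ∞) ≤ analyticOrderAt f 0 := by
    rw [Nat.cast_one, Order.one_le_iff_ne_zero]
    exact hf.analyticOrderAt_ne_zero.2 h0
  obtain ⟨g, hg, hfg⟩ := (natCast_le_analyticOrderAt hf).1 horder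
  exact ⟨g, hg, by simpa using hfg⟩

lemma analyticAtInfty_mul_comp_inv {f : ℂ → ℂ} (hf : AnalyticAt ℂ f 0) (h0 : f 0 = 0) :
    AnalyticAtInfty fun β => β * f (β : ℂ)⁻¹ := by
  obtain ⟨g, hg, hfg⟩ := exists_analyticAt_eq_mul hf h0
  refine ⟨g, hg, ?_⟩
  filter_upwards [tendsto_inv_ofReal_atTop_zero.eventually hfg,
    eventually_ofReal_ne_zero_atTop] with β hβ hβ0
  rw [hβ, mul_inv_cancel_left₀ hβ0]

lemma hasPoleAtInfty_mul_comp_inv {f : ℂ → ℂ} (hf : AnalyticAt ℂ f 0) (h0 : f 0 ≠ 0) :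
    HasPoleAtInfty fun β => β * f (β : ℂ)⁻¹ := by
  have hmero : MeromorphicAt (fun z => z ^ (-1 : ℤ) • f z) 0 :=
    ((MeromorphicAt.id 0).zpow (-1)).smul hf.meromorphicAt
  refine ⟨_, hmero, ?_, .of_forall fun β => ?_⟩
  · rw [(meromorphicOrderAt_eq_int_iff (n := -1) hmero).2 ⟨f, hf, h0, by simp⟩]
    exact_mod_cast neg_one_lt_zero
  · rw [zpow_neg_one, inv_inv, smul_eq_mul]

lemma AnalyticAtInfty.exists_tendsto {E : Type*} [NormedAddCommGroup E] [NormedSpace ℂ E]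
    {f : ℝ → E} (hf : AnalyticAtInfty f) : ∃ ρ, Tendsto f atTop (𝓝 ρ) := by
  obtain ⟨g, hg, hfg⟩ := hf
  exact ⟨g 0, (tendsto_comp_inv_ofReal_atTop hg.continuousAt).congr' (EventuallyEq.symm hfg)⟩

lemma AnalyticAtInfty.exists_isBigO_of_tendsto_zero {f : ℝ → ℂ} (hf : AnalyticAtInfty f)
    (h0 : Tendsto f atTop (𝓝 0)) :
    ∃ c : ℂ, (fun β : ℝ => f β - c * (β : ℂ)⁻¹) =O[atTop] fun β : ℝ => β ^ (-2 : ℤ) := by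
  obtain ⟨g, hg, hfg⟩ := hf
  have hg0 : g 0 = 0 := tendsto_nhds_unique
    ((tendsto_comp_inv_ofReal_atTop hg.continuousAt).congr' (EventuallyEq.symm hfg)) h0
  obtain ⟨h, hh, hgh⟩ := exists_analyticAt_eq_mul hg hg0
  obtain ⟨k, hk, hhk⟩ := exists_analyticAt_eq_mul (hh.fun_sub (analyticAt_const (v := h 0)))
    (sub_self _)
  have hfk : (fun β : ℝ => f β - h 0 * (β : ℂ)⁻¹) =ᶠ[atTop]
      fun β => (β : ℂ)⁻¹ ^ 2 * k (β : ℂ)⁻¹ := by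
    filter_upwards [hfg, tendsto_inv_ofReal_atTop_zero.eventually hgh,
      tendsto_inv_ofReal_atTop_zero.eventually hhk] with β hf hg hh
    rw [hf, hg, mul_comm (h 0), ← mul_sub, hh, ← mul_assoc, sq]
  have hsq : (fun β : ℝ => (β : ℂ)⁻¹ ^ 2) =O[atTop] fun β : ℝ => β ^ (-2 : ℤ) :=
    isBigO_of_le _ fun β => by simp [zpow_neg]
  have hbdd := (tendsto_comp_inv_ofReal_atTop hk.continuousAt).isBigO_one ℝ
  exact ⟨h 0, hfk.trans_isBigO (by simpa using hsq.mul hbdd)⟩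

lemma HasPoleAtInfty.not_tendsto_nhds {f : ℝ → ℂ} (hf : HasPoleAtInfty f) (ρ : ℂ) :
    ¬Tendsto f atTop (𝓝 ρ) := by
  obtain ⟨g, -, hneg, hfg⟩ := hf
  have hlim := (tendsto_cobounded_of_meromorphicOrderAt_neg hneg).comp tendsto_inv_ofReal_atTop
  exact (hlim.congr' (EventuallyEq.symm hfg)).not_tendsto (Metric.disjoint_nhds_cobounded ρ).symm

end AtInfinity

section HighLossLimit

open Polynomial

variable {N : ℕ} {α η θ R : Matrix (Fin N) (Fin N) ℝ}

lemma tendsto_eval_charpoly_systemOperator_mul_inv (hα : α.PosDef) (hη : η.PosDef) {μ : ℂ}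
    (hμ : μ ≠ 0) :
    Tendsto (fun β : ℝ => (systemOperator α η θ R β).charpoly.eval (μ * (β : ℂ)⁻¹)) atTop
      (𝓝 (((Kp α).det : ℂ) ^ 2 * ((Complex.I * μ) • complexify R - complexify η).det)) := by
  have hcont : Continuous fun x : ℂ => ((Kp α).det : ℂ) ^ 2 *
      ((μ * x) ^ 2 • complexify α + (Complex.I * (μ * x)) • (2 • complexify θ) +
        (Complex.I * μ) • complexify R - complexify η).det := by
    fun_prop
  refine ((hcont.tendsto' 0 _ ?_).comp tendsto_inv_ofReal_atTop_zero).congr' ?_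
  · simp
  filter_upwards [eventually_ofReal_ne_zero_atTop] with β hβ
  have hI : Complex.I * (μ * (β : ℂ)⁻¹) * β = Complex.I * μ := by
    rw [mul_assoc, inv_mul_cancel_right₀ hβ]
  rw [eval_charpoly_systemOperator hα hη β (mul_ne_zero hμ (inv_ne_zero hβ)), Function.comp,
    smul_add, smul_smul _ (β : ℂ), hI, ← add_assoc]

lemma det_smul_complexify_sub_eq_prod (hη : IsUnit η) {r : ℕ} {b : Fin r → ℝ}
    (hb : ListsNonzeroEigenvalues (η⁻¹ * R) b) (hb0 : ∀ k, b k ≠ 0) (μ : ℂ) :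
    ((Complex.I * μ) • complexify R - complexify η).det =
      ((-complexify η).det * ∏ k, (-Complex.I * b k)) *
        ∏ k, (μ - -Complex.I * ((1 / b k : ℝ) : ℂ)) := by
  have hR : complexify η * complexify (η⁻¹ * R) = complexify R := by
    rw [← complexify_mul, Matrix.mul_nonsing_inv_cancel_left _ _
      ((Matrix.isUnit_iff_isUnit_det _).1 hη)]
  have hfactor : (Complex.I * μ) • complexify R - complexify η =
      (-complexify η) * (1 - (Complex.I * μ) • complexify (η⁻¹ * R)) := by
    rw [mul_sub, mul_one, Matrix.mul_smul, neg_mul, hR]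
    module
  rw [hfactor, Matrix.det_mul, hb.det_one_sub_smul, mul_assoc, ← Finset.prod_mul_distrib]
  congr 1
  refine Finset.prod_congr rfl fun k _ => ?_
  have hk : (b k : ℂ) ≠ 0 := Complex.ofReal_ne_zero.2 (hb0 k)
  push_cast
  field_simp
  linear_combination Complex.I_sq

end HighLossLimit

section Existence

lemma tendsto_I_mul_inv_ofReal_atTop_zero :
    Tendsto (fun β : ℝ => Complex.I * (β : ℂ)⁻¹) atTop (𝓝 0) := by
  simpa using tendsto_inv_ofReal_atTop_zero.const_mul Complex.I

lemma analyticAt_comp_I_mul {E : Type*} [NormedAddCommGroup E] [NormedSpace ℂ E] {f : ℂ → E}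
    (hf : AnalyticAt ℂ f 0) : AnalyticAt ℂ (fun z => f (Complex.I * z)) 0 :=
  AnalyticAt.fun_comp (by rwa [mul_zero]) (analyticAt_const.mul analyticAt_id)

lemma exists_equiv_fin_iff_lt {κ : Type*} [Fintype κ] {n r : ℕ} {p : κ → Prop} [DecidablePred p]
    (hn : Fintype.card κ = n) (hr : Fintype.card {i // p i} = r) :
    ∃ e : Fin n ≃ κ, ∀ j : Fin n, p (e j) ↔ (j : ℕ) < r := by
  let e₀ : Fin n ≃ κ := (Fintype.equivFinOfCardEq hn).symm
  have hrn : r ≤ n := hn ▸ hr ▸ Fintype.card_subtype_le p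
  let e₁ : {j : Fin n // (j : ℕ) < r} ≃ {j : Fin n // p (e₀ j)} := Fintype.equivOfCardEq <| by
    rw [Fintype.card_fin_lt_of_le hrn, ← hr, Fintype.card_congr (e₀.subtypeEquiv fun _ => Iff.rfl)]
  refine ⟨e₁.extendSubtype.trans e₀, fun j => ⟨fun hj => ?_, e₁.extendSubtype_mem j⟩⟩
  by_contra hjr
  exact e₁.extendSubtype_not_mem j hjr hj

variable {N : ℕ} {α η θ R : Matrix (Fin N) (Fin N) ℝ}

lemma systemOperator_eq_smul_pencil {β : ℝ} (hβ : (β : ℂ) ≠ 0) :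
    systemOperator α η θ R β = (β * -Complex.I) •
      (dissipationOperator α R + (Complex.I * (β : ℂ)⁻¹) • frequencyOperator α η θ) := by
  have hone : β * -Complex.I * (Complex.I * (β : ℂ)⁻¹) = 1 := by
    rw [mul_assoc, neg_mul, ← mul_assoc Complex.I, Complex.I_mul_I, neg_one_mul, neg_neg,
      mul_inv_cancel₀ hβ]
  rw [systemOperator, smul_add, smul_smul, hone, one_smul]
  module

lemma card_ne_zero_eq_rank (hα : α.PosDef) (hR : R.PosSemidef) {κ : Type*} [Fintype κ] {μ : κ → ℂ}
    (b : Module.Basis κ ℂ (Fin N ⊕ Fin N → ℂ))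
    (hb : ∀ i, dissipationOperator α R *ᵥ b i = μ i • b i) [DecidablePred (μ · ≠ 0)] :
    Fintype.card {i // μ i ≠ 0} = R.rank := by
  rw [← card_filter_roots_charpoly_dissipationOperator hα hR, charpoly_eq_prod_of_eigenbasis b hb,
    roots_prod_univ_X_sub_C, Multiset.filter_map, Multiset.card_map, Fintype.card_subtype,
    Finset.card_def, Finset.filter_val]
  congr!

theorem exists_isHighLossEigenbasis (hα : α.PosDef) (hθ : θᵀ = -θ) (hR : R.PosSemidef) :
    ∃ (ζ : Fin (2 * N) → ℝ → ℂ) (w : Fin (2 * N) → ℝ → Fin N ⊕ Fin N → ℂ),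
      IsHighLossEigenbasis α η θ R ζ w := by
  classical
  obtain ⟨b, μ, v, h⟩ := exists_analytic_eigenbasis_of_isHermitian
    (isHermitian_dissipationOperator α hR) (isHermitian_frequencyOperator α η hθ)
  choose hμ hv hv0 heig using h
  have hb (i) : dissipationOperator α R *ᵥ b i = μ i 0 • b i := by
    simpa [hv0] using (heig i).self_of_nhds
  obtain ⟨e, he⟩ := exists_equiv_fin_iff_lt (n := 2 * N)
    (by rw [Fintype.card_sum, Fintype.card_fin, two_mul]) (card_ne_zero_eq_rank hα hR b hb)
  have hf (j) := analyticAt_const (v := -Complex.I).mul (analyticAt_comp_I_mul (hμ (e j)))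
  have hb_indep : LinearIndependent ℂ fun i => v i 0 := by
    simpa only [hv0] using b.linearIndependent
  have hindep : ∀ᶠ z in 𝓝 0, LinearIndependent ℂ fun i => v i z :=
    (continuousAt_pi.2 fun i => (hv i).continuousAt).eventually hb_indep.eventually
  refine ⟨fun j β => β * (-Complex.I * μ (e j) (Complex.I * (β : ℂ)⁻¹)),
    fun j β => v (e j) (Complex.I * (β : ℂ)⁻¹), ?_, ?_,
    fun j => ⟨_, analyticAt_comp_I_mul (hv (e j)), .of_forall fun β => rfl⟩,
    fun j hj => hasPoleAtInfty_mul_comp_inv (hf j) ?_,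
    fun j hj => analyticAtInfty_mul_comp_inv (hf j) ?_⟩
  · filter_upwards [tendsto_I_mul_inv_ofReal_atTop_zero.eventually hindep] with β hβ
    have hβe := hβ.comp e e.injective
    exact ⟨hβe, hβe.span_eq_top_of_card_eq_finrank' (by simp [two_mul])⟩
  · filter_upwards [tendsto_I_mul_inv_ofReal_atTop_zero.eventually (eventually_all.2 heig),
      eventually_ofReal_ne_zero_atTop] with β hβ hβ0 j
    rw [systemOperator_eq_smul_pencil hβ0, Matrix.smul_mulVec, hβ (e j), smul_smul, mul_assoc]
  · simpa using (he j).2 hj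
  · simpa using (not_congr (he j)).2 hj.not_gt

end Existence

section ScalingLimit

open Polynomial

lemma le_of_tendsto_zpow_mul {n m : ℤ} {f : ℝ → ℂ} {x y : ℂ} (hy : y ≠ 0)
    (hn : Tendsto (fun β : ℝ => (β : ℂ) ^ n * f β) atTop (𝓝 x))
    (hm : Tendsto (fun β : ℝ => (β : ℂ) ^ m * f β) atTop (𝓝 y)) : n ≤ m := by
  by_contra! hmn
  have hzero := (tendsto_ofReal_zpow_atTop_zero (sub_neg.2 hmn)).mul hn
  rw [zero_mul] at hzero
  refine hy (tendsto_nhds_unique hm (hzero.congr' ?_))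
  filter_upwards [eventually_ofReal_ne_zero_atTop] with β hβ
  rw [← mul_assoc, ← zpow_add₀ hβ, sub_add_cancel]

/-- The roots of the polynomials `F β`, magnified by the factor `β`, tend to those of `q` as
`β → ∞`, in the sense that `F β` at the scale `β⁻¹` converges to `q` after multiplication by a
power of `β`. The point `μ = 0` is left out because the characteristic polynomial of the system
operator is evaluated through a Schur complement that degenerates there. -/
def HasScalingLimit (F : ℝ → ℂ[X]) (q : ℂ[X]) : Prop :=
  ∃ n : ℤ, ∀ μ : ℂ, μ ≠ 0 →
    Tendsto (fun β : ℝ => (β : ℂ) ^ n * (F β).eval (μ * (β : ℂ)⁻¹)) atTop (𝓝 (q.eval μ))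

namespace HasScalingLimit

variable {F G : ℝ → ℂ[X]} {p q : ℂ[X]}

lemma congr' (hF : HasScalingLimit F p) (hFG : F =ᶠ[atTop] G) : HasScalingLimit G p := by
  obtain ⟨n, hn⟩ := hF
  refine ⟨n, fun μ hμ => (hn μ hμ).congr' ?_⟩
  filter_upwards [hFG] with β hβ
  rw [hβ]

lemma mul (hF : HasScalingLimit F p) (hG : HasScalingLimit G q) :
    HasScalingLimit (fun β => F β * G β) (p * q) := by
  obtain ⟨n, hn⟩ := hF
  obtain ⟨m, hm⟩ := hG
  refine ⟨n + m, fun μ hμ => ?_⟩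
  rw [eval_mul]
  refine ((hn μ hμ).mul (hm μ hμ)).congr' ?_
  filter_upwards [eventually_ofReal_ne_zero_atTop] with β hβ
  rw [eval_mul, zpow_add₀ hβ, mul_mul_mul_comm]

lemma prod {κ : Type*} (s : Finset κ) {F : κ → ℝ → ℂ[X]} {q : κ → ℂ[X]}
    (h : ∀ i, HasScalingLimit (F i) (q i)) :
    HasScalingLimit (fun β => ∏ i ∈ s, F i β) (∏ i ∈ s, q i) := by
  induction s using Finset.cons_induction with
  | empty => exact ⟨0, by simp⟩
  | cons i s hi ih => simpa only [Finset.prod_cons] using (h i).mul ih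

lemma unique (hp : HasScalingLimit F p) (hq : HasScalingLimit F q) (hp0 : p ≠ 0) (hq0 : q ≠ 0) :
    p = q := by
  obtain ⟨n, hn⟩ := hp
  obtain ⟨m, hm⟩ := hq
  obtain ⟨μ, hμ⟩ : ∃ μ, (X * p * q).eval μ ≠ 0 := by
    by_contra! hzero
    exact mul_ne_zero (mul_ne_zero X_ne_zero hp0) hq0 (Polynomial.funext (by simpa using hzero))
  simp only [eval_mul, eval_X, mul_ne_zero_iff] at hμ
  obtain ⟨⟨hμ0, hpμ⟩, hqμ⟩ := hμ
  have hnm : n = m := le_antisymm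
    (le_of_tendsto_zpow_mul hqμ (hn μ hμ0) (hm μ hμ0))
    (le_of_tendsto_zpow_mul hpμ (hm μ hμ0) (hn μ hμ0))
  subst hnm
  refine eq_of_infinite_eval_eq p q ((Set.finite_singleton (0 : ℂ)).infinite_compl.mono ?_)
  exact fun μ hμ => tendsto_nhds_unique (hn μ hμ) (hm μ hμ)

end HasScalingLimit

lemma hasScalingLimit_X_sub_C_of_isBigO {f : ℝ → ℂ} {c : ℂ}
    (hf : (fun β : ℝ => f β - c * (β : ℂ)⁻¹) =O[atTop] fun β : ℝ => β ^ (-2 : ℤ)) :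
    HasScalingLimit (fun β => X - C (f β)) (X - C c) := by
  have hid : (fun β : ℝ => (β : ℂ)) =O[atTop] fun β : ℝ => β :=
    isBigO_of_le _ fun β => by rw [Complex.norm_real]
  have hO : (fun β : ℝ => (β : ℂ) * (f β - c * (β : ℂ)⁻¹)) =O[atTop] fun β : ℝ => β ^ (-1 : ℤ) := by
    refine (hid.mul hf).trans_eventuallyEq ?_
    filter_upwards [eventually_ne_atTop 0] with β hβ
    rw [← zpow_one_add₀ hβ]
    norm_num
  refine ⟨1, fun μ _ => ?_⟩
  have hlim := (hO.trans_tendsto (tendsto_zpow_atTop_zero (by norm_num))).const_sub (μ - c)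
  rw [sub_zero] at hlim
  rw [eval_sub, eval_X, eval_C]
  refine hlim.congr' ?_
  filter_upwards [eventually_ofReal_ne_zero_atTop] with β hβ
  rw [eval_sub, eval_X, eval_C]
  field_simp
  ring

lemma hasScalingLimit_X_sub_C_of_tendsto {f : ℝ → ℂ} {ρ : ℂ} (hf : Tendsto f atTop (𝓝 ρ)) :
    HasScalingLimit (fun β => X - C (f β)) (C (-ρ)) :=
  ⟨0, fun μ _ => by simpa using (tendsto_inv_ofReal_atTop_zero.const_mul μ).sub hf⟩

lemma HasPoleAtInfty.exists_hasScalingLimit_X_sub_C {f : ℝ → ℂ} (hf : HasPoleAtInfty f) :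
    ∃ E ≠ 0, HasScalingLimit (fun β => X - C (f β)) (C E) := by
  obtain ⟨g, hg, hneg, hfg⟩ := hf
  obtain ⟨n, hn⟩ := WithTop.ne_top_iff_exists.1 (ne_top_of_lt hneg)
  obtain ⟨h, hh, hh0, hgh⟩ := (meromorphicOrderAt_eq_int_iff hg).1 hn.symm
  have hn0 : n < 0 := by
    rw [← hn] at hneg
    exact_mod_cast hneg
  refine ⟨-h 0, neg_ne_zero.2 hh0, n, fun μ _ => ?_⟩
  have hlim := ((tendsto_ofReal_zpow_atTop_zero hn0).mul
    (tendsto_inv_ofReal_atTop_zero.const_mul μ)).sub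
      (tendsto_comp_inv_ofReal_atTop hh.continuousAt)
  rw [zero_mul, zero_sub] at hlim
  rw [eval_C]
  refine hlim.congr' ?_
  filter_upwards [hfg, tendsto_inv_ofReal_atTop.eventually hgh,
    eventually_ofReal_ne_zero_atTop] with β hfβ hgβ hβ
  rw [eval_sub, eval_X, eval_C, hfβ, hgβ, sub_zero, smul_eq_mul, mul_sub, inv_zpow,
    mul_inv_cancel_left₀ (zpow_ne_zero _ hβ)]

lemma exists_equiv_of_map_univ_eq {κ κ' γ : Type*} [Fintype κ] [Fintype κ'] {f : κ → γ}
    {g : κ' → γ} (h : Finset.univ.val.map f = Finset.univ.val.map g) :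
    ∃ e : κ ≃ κ', ∀ k, g (e k) = f k := by
  classical
  have hfiber (x : γ) : Nonempty ({k // f k = x} ≃ {k // g k = x}) := by
    rw [← Fintype.card_eq, Fintype.card_subtype, Fintype.card_subtype]
    simpa [Multiset.count_map, Finset.card_def, Finset.filter_val, eq_comm] using
      congrArg (Multiset.count x) h
  exact ⟨Equiv.ofFiberEquiv fun x => (hfiber x).some, fun k => Equiv.ofFiberEquiv_map _ k⟩

lemma exists_equiv_isBigO_of_hasScalingLimit {κ : Type*} [Fintype κ] {r : ℕ} {ζ : κ → ℝ → ℂ}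
    {D : ℂ} {a : Fin r → ℂ} (hζ : ∀ j, AnalyticAtInfty (ζ j) ∨ HasPoleAtInfty (ζ j)) (hD : D ≠ 0)
    (hlim : HasScalingLimit (fun β => ∏ j, (X - C (ζ j β))) (C D * ∏ k, (X - C (a k)))) :
    ∃ e : Fin r ≃ {j // Tendsto (ζ j) atTop (𝓝 0)},
      ∀ k, (fun β : ℝ => ζ (e k) β - a k * (β : ℂ)⁻¹) =O[atTop] fun β : ℝ => β ^ (-2 : ℤ) := by
  classical
  have hvanishing (j : {j // Tendsto (ζ j) atTop (𝓝 0)}) :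
      ∃ c : ℂ, (fun β : ℝ => ζ j β - c * (β : ℂ)⁻¹) =O[atTop] fun β : ℝ => β ^ (-2 : ℤ) :=
    ((hζ j).resolve_right fun h => h.not_tendsto_nhds 0 j.2).exists_isBigO_of_tendsto_zero j.2
  have hother (j : {j // ¬Tendsto (ζ j) atTop (𝓝 0)}) :
      ∃ E ≠ 0, HasScalingLimit (fun β => X - C (ζ j β)) (C E) := by
    rcases hζ j with h | h
    · obtain ⟨ρ, hρ⟩ := h.exists_tendsto
      have hρ0 : ρ ≠ 0 := fun h0 => j.2 (h0 ▸ hρ)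
      exact ⟨-ρ, neg_ne_zero.2 hρ0, hasScalingLimit_X_sub_C_of_tendsto hρ⟩
    · exact h.exists_hasScalingLimit_X_sub_C
  choose c hc using hvanishing
  choose E hE0 hE using hother
  have hE_prod : ∏ j, E j ≠ 0 := Finset.prod_ne_zero_iff.2 fun j _ => hE0 j
  have hfactors := (HasScalingLimit.prod .univ fun j => hasScalingLimit_X_sub_C_of_isBigO
    (hc j)).mul (HasScalingLimit.prod .univ hE)
  rw [← map_prod, mul_comm _ (C _)] at hfactors
  have hpoly := hlim.unique (hfactors.congr' <| .of_forall fun β =>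
      Fintype.prod_subtype_mul_prod_subtype _ fun j => X - C (ζ j β))
    (mul_ne_zero (C_ne_zero.2 hD) (monic_prod_X_sub_C a _).ne_zero)
    (mul_ne_zero (C_ne_zero.2 hE_prod) (monic_prod_X_sub_C c _).ne_zero)
  have hroots := congrArg Polynomial.roots hpoly
  rw [roots_C_mul _ hD, roots_C_mul _ hE_prod, roots_prod_univ_X_sub_C,
    roots_prod_univ_X_sub_C] at hroots
  obtain ⟨e, he⟩ := exists_equiv_of_map_univ_eq hroots
  exact ⟨e, fun k => he k ▸ hc (e k)⟩

end ScalingLimit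

section LowLossLimits

lemma tendsto_const_mulVec {n : Type*} [Fintype n] (M : Matrix n n ℂ) {v : ℝ → n → ℂ} {v₀ : n → ℂ}
    (hv : Tendsto v atTop (𝓝 v₀)) : Tendsto (fun β => M *ᵥ v β) atTop (𝓝 (M *ᵥ v₀)) :=
  (continuous_const.matrix_mulVec continuous_id).continuousAt.tendsto.comp hv

lemma tendsto_const_dotProduct {n : Type*} [Fintype n] (u : n → ℂ) {v : ℝ → n → ℂ} {v₀ : n → ℂ}
    (hv : Tendsto v atTop (𝓝 v₀)) : Tendsto (fun β => u ⬝ᵥ v β) atTop (𝓝 (u ⬝ᵥ v₀)) :=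
  (continuous_const.dotProduct continuous_id).continuousAt.tendsto.comp hv

section Pencil

variable {n : Type*} [Fintype n] {Ω B : Matrix n n ℂ} {v : ℝ → n → ℂ} {v₀ : n → ℂ} {ζ : ℝ → ℂ}
  {ρ : ℂ}

lemma mulVec_eq_zero_of_tendsto_eigenvector
    (heig : ∀ᶠ β : ℝ in atTop, (Ω - (Complex.I * (β : ℂ)) • B) *ᵥ v β = ζ β • v β)
    (hv : Tendsto v atTop (𝓝 v₀)) (hζ : Tendsto ζ atTop (𝓝 ρ)) : B *ᵥ v₀ = 0 := by
  have hlim := (tendsto_inv_ofReal_atTop_zero.const_mul (-Complex.I)).smul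
    ((tendsto_const_mulVec Ω hv).sub (hζ.smul hv))
  rw [mul_zero, zero_smul] at hlim
  refine tendsto_nhds_unique (tendsto_const_mulVec B hv) (hlim.congr' ?_)
  filter_upwards [heig, eventually_ofReal_ne_zero_atTop] with β hβ hβ0
  have hone : -Complex.I * (β : ℂ)⁻¹ * (Complex.I * β) = 1 := by
    rw [mul_mul_mul_comm, inv_mul_cancel₀ hβ0, neg_mul, Complex.I_mul_I, neg_neg, one_mul]
  rw [← hβ, Matrix.sub_mulVec, Matrix.smul_mulVec, sub_sub_cancel, smul_smul, hone, one_smul]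

lemma star_dotProduct_mulVec_of_tendsto_eigenvector (hB : B.IsHermitian)
    (heig : ∀ᶠ β : ℝ in atTop, (Ω - (Complex.I * (β : ℂ)) • B) *ᵥ v β = ζ β • v β)
    (hv : Tendsto v atTop (𝓝 v₀)) (hζ : Tendsto ζ atTop (𝓝 ρ)) :
    star v₀ ⬝ᵥ (Ω *ᵥ v₀) = ρ * (star v₀ ⬝ᵥ v₀) := by
  refine tendsto_nhds_unique (tendsto_const_dotProduct _ (tendsto_const_mulVec Ω hv))
    ((hζ.mul (tendsto_const_dotProduct _ hv)).congr' ?_)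
  filter_upwards [heig] with β hβ
  have hker : star v₀ ⬝ᵥ (B *ᵥ v β) = 0 := by
    rw [Matrix.dotProduct_mulVec, ← hB.eq, ← Matrix.star_mulVec,
      mulVec_eq_zero_of_tendsto_eigenvector heig hv hζ, star_zero, zero_dotProduct]
  rw [← smul_eq_mul, ← dotProduct_smul, ← hβ, Matrix.sub_mulVec, Matrix.smul_mulVec,
    dotProduct_sub, dotProduct_smul, hker, smul_zero, sub_zero]

open scoped ComplexOrder in
lemma im_eq_zero_of_tendsto_eigenvector (hΩ : Ω.IsHermitian) (hB : B.IsHermitian) (hv₀ : v₀ ≠ 0)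
    (heig : ∀ᶠ β : ℝ in atTop, (Ω - (Complex.I * (β : ℂ)) • B) *ᵥ v β = ζ β • v β)
    (hv : Tendsto v atTop (𝓝 v₀)) (hζ : Tendsto ζ atTop (𝓝 ρ)) : ρ.im = 0 := by
  have hpos : 0 < star v₀ ⬝ᵥ v₀ := Matrix.dotProduct_star_self_pos_iff.2 hv₀
  obtain ⟨hre, him⟩ := Complex.pos_iff.1 hpos
  have hquad := hΩ.im_star_dotProduct_mulVec_self v₀
  rw [star_dotProduct_mulVec_of_tendsto_eigenvector hB heig hv hζ] at hquad
  simpa [← him, hre.ne'] using hquad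

end Pencil

lemma AnalyticAtInfty.exists_tendsto_ne_zero_eq_smul {E : Type*} [NormedAddCommGroup E]
    [NormedSpace ℂ E] {w : ℝ → E} (hw : AnalyticAtInfty w) (hw0 : ∃ᶠ β in atTop, w β ≠ 0) :
    ∃ (c : ℝ → ℂ) (v : ℝ → E) (v₀ : E), v₀ ≠ 0 ∧ Tendsto v atTop (𝓝 v₀) ∧
      ∀ᶠ β in atTop, c β ≠ 0 ∧ w β = c β • v β := by
  obtain ⟨g, hg, hwg⟩ := hw
  have hg0 : ¬∀ᶠ z in 𝓝 0, g z = 0 := fun hzero => hw0 <| by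
    filter_upwards [hwg, tendsto_inv_ofReal_atTop_zero.eventually hzero] with β hβ hβ0
    exact not_not.2 (hβ.trans hβ0)
  obtain ⟨k, u, hu, hu0, hgu⟩ := hg.exists_eventuallyEq_pow_smul_nonzero_iff.2 hg0
  refine ⟨fun β => (β : ℂ)⁻¹ ^ k, fun β => u (β : ℂ)⁻¹, u 0, hu0,
    tendsto_comp_inv_ofReal_atTop hu.continuousAt, ?_⟩
  filter_upwards [hwg, tendsto_inv_ofReal_atTop_zero.eventually hgu,
    eventually_ofReal_ne_zero_atTop] with β hβ hgβ hβ0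
  exact ⟨pow_ne_zero k (inv_ne_zero hβ0), by rw [hβ, hgβ, sub_zero]⟩

end LowLossLimits

section Reindexing

lemma exists_equiv_fin_shift {n r : ℕ} (h : 2 * r ≤ n) :
    ∃ g : {j : {j : Fin n // r ≤ (j : ℕ)} // (j : ℕ) < 2 * r} ≃ Fin r,
      ∀ j, (g j : ℕ) = (j : ℕ) - r := by
  refine ⟨⟨fun j => ⟨j - r, by omega⟩, fun k => ⟨⟨⟨k + r, by omega⟩, Nat.le_add_left r k⟩, ?_⟩,
    fun j => ?_, fun k => ?_⟩, fun j => rfl⟩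
  · exact (Nat.add_lt_add_right k.2 r).trans_eq (two_mul r).symm
  · exact Subtype.ext (Subtype.ext (Fin.ext (Nat.sub_add_cancel j.1.2)))
  · exact Fin.ext (Nat.add_sub_cancel k r)

lemma exists_perm_of_equiv_subtype {n r : ℕ} {P : Fin n → Prop} (e : Fin r ≃ {j // P j})
    (hP : ∀ j, P j → r ≤ (j : ℕ)) (hn : 2 * r ≤ n) :
    ∃ σ : Equiv.Perm (Fin n), (∀ j : Fin n, (j : ℕ) < r → σ j = j) ∧
      (∀ (j : Fin n) (_ : r ≤ (j : ℕ)) (_ : (j : ℕ) < 2 * r), σ j = e ⟨(j : ℕ) - r, by omega⟩) ∧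
      ∀ j : Fin n, 2 * r ≤ (j : ℕ) → r ≤ (σ j : ℕ) ∧ ¬P (σ j) := by
  classical
  obtain ⟨g, hg⟩ := exists_equiv_fin_shift hn
  let e' := (g.trans e).trans (Equiv.subtypeSubtypeEquivSubtype (hP _)).symm
  let τ := e'.extendSubtype
  refine ⟨Equiv.Perm.ofSubtype τ, fun j hj => ?_, fun j hrj hj => ?_, fun j hj => ?_⟩
  · exact Equiv.Perm.ofSubtype_apply_of_not_mem τ hj.not_ge
  · rw [Equiv.Perm.ofSubtype_apply_of_mem τ hrj, e'.extendSubtype_apply_of_mem ⟨j, hrj⟩ hj]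
    exact congrArg (fun k => (e k : Fin n)) (Fin.ext (hg _))
  · have hrj : r ≤ (j : ℕ) := by omega
    rw [Equiv.Perm.ofSubtype_apply_of_mem τ hrj]
    exact ⟨(τ _).2, e'.extendSubtype_not_mem ⟨j, hrj⟩ hj.not_gt⟩

end Reindexing

section HighLossEigenbasis

open Polynomial

variable {N : ℕ} {α η θ R : Matrix (Fin N) (Fin N) ℝ}

lemma exists_hasScalingLimit_charpoly_systemOperator (hα : α.PosDef) (hη : η.PosDef)
    {b : Fin R.rank → ℝ} (hb : ListsNonzeroEigenvalues (η⁻¹ * R) b) (hb0 : ∀ k, b k ≠ 0) :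
    ∃ D ≠ 0, HasScalingLimit (fun β => (systemOperator α η θ R β).charpoly)
      (C D * ∏ k, (X - C (-Complex.I * ((1 / b k : ℝ) : ℂ)))) := by
  refine ⟨((Kp α).det : ℂ) ^ 2 * ((-complexify η).det * ∏ k, (-Complex.I * b k)),
    mul_ne_zero (pow_ne_zero _ ?_) (mul_ne_zero ?_ ?_), 0, fun μ hμ => ?_⟩
  · exact Complex.ofReal_ne_zero.2 (isUnit_det_Kp hα).ne_zero
  · rw [← complexify_neg, det_complexify, Complex.ofReal_ne_zero, Matrix.det_neg]
    exact mul_ne_zero (pow_ne_zero _ (neg_ne_zero.2 one_ne_zero)) hη.det_pos.ne'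
  · exact Finset.prod_ne_zero_iff.2 fun k _ =>
      mul_ne_zero (neg_ne_zero.2 Complex.I_ne_zero) (Complex.ofReal_ne_zero.2 (hb0 k))
  · have hlim := tendsto_eval_charpoly_systemOperator_mul_inv (θ := θ) (R := R) hα hη hμ
    rw [det_smul_complexify_sub_eq_prod hη.isUnit hb hb0, ← mul_assoc] at hlim
    simpa only [zpow_zero, one_mul, eval_mul, eval_C, eval_prod, eval_sub, eval_X] using hlim

namespace IsHighLossEigenbasis

variable {ζ : Fin (2 * N) → ℝ → ℂ} {w : Fin (2 * N) → ℝ → Fin N ⊕ Fin N → ℂ}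

lemma charpoly_eq_prod (h : IsHighLossEigenbasis α η θ R ζ w) :
    ∀ᶠ β in atTop, (systemOperator α η θ R β).charpoly = ∏ j, (X - C (ζ j β)) := by
  filter_upwards [h.basis, h.eigen] with β hbasis heigen
  exact charpoly_eq_prod_of_eigenbasis (Module.Basis.mk hbasis.1 hbasis.2.ge) fun j => by
    rw [Module.Basis.mk_apply, heigen j]

lemma rank_le_of_tendsto (h : IsHighLossEigenbasis α η θ R ζ w) {j : Fin (2 * N)} {ρ : ℂ}
    (hρ : Tendsto (ζ j) atTop (𝓝 ρ)) : R.rank ≤ (j : ℕ) :=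
  le_of_not_gt fun hj => (h.highLoss j hj).not_tendsto_nhds ρ hρ

theorem exists_equiv_isBigO (h : IsHighLossEigenbasis α η θ R ζ w) (hα : α.PosDef) (hη : η.PosDef)
    {b : Fin R.rank → ℝ} (hb : ListsNonzeroEigenvalues (η⁻¹ * R) b) (hb0 : ∀ k, b k ≠ 0) :
    ∃ e : Fin R.rank ≃ {j // Tendsto (ζ j) atTop (𝓝 0)},
      ∀ k, (fun β : ℝ => ζ (e k) β - (-Complex.I * ((1 / b k : ℝ) : ℂ) * (β : ℂ)⁻¹))
        =O[atTop] fun β : ℝ => β ^ (-2 : ℤ) := by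
  obtain ⟨D, hD, hlim⟩ := exists_hasScalingLimit_charpoly_systemOperator (θ := θ) hα hη hb hb0
  exact exists_equiv_isBigO_of_hasScalingLimit
    (fun j => (le_or_gt R.rank j).imp (h.lowLoss j) (h.highLoss j)) hD
    (hlim.congr' h.charpoly_eq_prod)

theorem exists_real_tendsto (h : IsHighLossEigenbasis α η θ R ζ w) (hθ : θᵀ = -θ)
    (hR : R.PosSemidef) {j : Fin (2 * N)} (hj : R.rank ≤ (j : ℕ)) :
    ∃ ρ : ℝ, Tendsto (ζ j) atTop (𝓝 (ρ : ℂ)) := by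
  obtain ⟨ρ, hρ⟩ := (h.lowLoss j hj).exists_tendsto
  have hw0 : ∀ᶠ β in atTop, w j β ≠ 0 := h.basis.mono fun β hβ => hβ.1.ne_zero j
  obtain ⟨c, v, v₀, hv₀, hv, hwv⟩ :=
    (h.analytic_vec j).exists_tendsto_ne_zero_eq_smul hw0.frequently
  have heig : ∀ᶠ β in atTop, systemOperator α η θ R β *ᵥ v β = ζ j β • v β := by
    filter_upwards [h.eigen, hwv] with β hβ hwβ
    have hjβ := hβ j
    rw [hwβ.2, Matrix.mulVec_smul, smul_comm] at hjβ
    exact smul_right_injective _ hwβ.1 hjβ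
  have him := im_eq_zero_of_tendsto_eigenvector (isHermitian_frequencyOperator α η hθ)
    (isHermitian_dissipationOperator α hR) hv₀ heig hv hρ
  lift ρ to ℝ using him
  exact ⟨ρ, hρ⟩

end IsHighLossEigenbasis

end HighLossEigenbasis

end

theorem mainTheorem12 (N : ℕ) (α η θ R : Matrix (Fin N) (Fin N) ℝ)
    (hα : α.PosDef) (hη : η.PosDef) (hθ : θᵀ = -θ) (hR : R.PosSemidef) (hR0 : 0 < R.rank) :
    ∃ b : Fin R.rank → ℝ,
      ListsNonzeroEigenvalues (η⁻¹ * R) b ∧ (∀ k, 0 < b k) ∧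
      (∃ (ζ : Fin (2 * N) → ℝ → ℂ) (w : Fin (2 * N) → ℝ → Fin N ⊕ Fin N → ℂ),
        IsHighLossEigenbasis α η θ R ζ w) ∧
      ∀ (ζ : Fin (2 * N) → ℝ → ℂ) (w : Fin (2 * N) → ℝ → Fin N ⊕ Fin N → ℂ),
        IsHighLossEigenbasis α η θ R ζ w →
        ∃ σ : Equiv.Perm (Fin (2 * N)),
          (∀ j : Fin (2 * N), (j : ℕ) < R.rank → σ j = j) ∧
          (∀ (j : Fin (2 * N)) (_ : R.rank ≤ (j : ℕ)) (_ : (j : ℕ) < 2 * R.rank),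
            Tendsto (ζ (σ j)) atTop (𝓝 0) ∧
            (fun β : ℝ => ζ (σ j) β -
                (-Complex.I * ((1 / b ⟨(j : ℕ) - R.rank, by omega⟩ : ℝ) : ℂ) * (β : ℂ)⁻¹))
              =O[atTop] fun β : ℝ => β ^ (-2 : ℤ)) ∧
          (∀ j : Fin (2 * N), 2 * R.rank ≤ (j : ℕ) →
            ∃ ρ : ℝ, ρ ≠ 0 ∧ Tendsto (ζ (σ j)) atTop (𝓝 (ρ : ℂ))) := by
  obtain ⟨b, hb, hb0⟩ := exists_listsNonzeroEigenvalues_inv_mul hη hR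
  refine ⟨b, hb, hb0, exists_isHighLossEigenbasis hα hθ hR, fun ζ w h => ?_⟩
  obtain ⟨e, he⟩ := h.exists_equiv_isBigO hα hη hb fun k => (hb0 k).ne'
  obtain ⟨σ, hσ_fix, hσ_vanishing, hσ_rest⟩ := exists_perm_of_equiv_subtype e
    (fun j => h.rank_le_of_tendsto) (Nat.mul_le_mul_left 2 R.rank_le_width)
  refine ⟨σ, hσ_fix, fun j hrj hj => ?_, fun j hj => ?_⟩
  · rw [hσ_vanishing j hrj hj]
    exact ⟨(e _).2, he _⟩
  · obtain ⟨hσj, hlim⟩ := hσ_rest j hj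
    obtain ⟨ρ, hρ⟩ := h.exists_real_tendsto hθ hR hσj
    refine ⟨ρ, ?_, hρ⟩
    rintro rfl
    exact hlim hρ
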